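/- All vector spaces are over $\mathbb{C}$. Let $\mathrm{QSym}$ be the graded Hopf algebra of quasisymmetric functions with monomial basis $M_\alpha$ ($\alpha$ a composition), and let $\zeta_{\mathrm{QSym}}$ be its character $f\mapsto f(1,0,0,\dots)$. For a character $\zeta$ write $\zeta^{-1}$ for its convolution inverse and $\bar\zeta$ for the character equal to $(-1)^n\zeta$ in degree $n$. A combinatorial Hopf algebra is a pair $(\mathsf H,\zeta)$ of a graded connected Hopf algebra $\mathsf H$ and a character $\zeta:\mathsf H\to\mathbb{C}$; a morphism $(\mathsf H,\zeta)\to(\mathsf H',\zeta')$ is a graded Hopf morphism $\Phi$ with $\zeta'\circ\Phi=\zeta$. Let $\Theta_{\mathrm{QSym}}$ be the unique morphism of combinatorial Hopf algebras $(\mathrm{QSym},\overline{\zeta_{\mathrm{QSym}}^{-1}}\,\zeta_{\mathrm{QSym}})\to(\mathrm{QSym},\zeta_{\mathrm{QSym}})$, and let $\Pi$ be its image. A theta map for $(\mathsf H,\zeta)$ is a linear map $\Theta:\mathsf H\to\mathsf H$ with $\Phi\circ\Theta=\Theta_{\mathrm{QSym}}\circ\Phi$, where $\Phi:(\mathsf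 H,\zeta)\to(\mathrm{QSym},\zeta_{\mathrm{QSym}})$ is the unique morphism of combinatorial Hopf algebras; the image of a theta map is called a peak algebra for $(\mathsf H,\zeta)$. For a composition $\alpha=(\alpha_1,\dots,\alpha_\ell)$ put $S_\alpha=\sum_\beta c_\alpha^\beta M_\beta$. The sum runs over the compositions $\beta$ obtained by cutting $\alpha$ into consecutive nonempty blocks, in none of which an odd part is immediately followed by an even part, and replacing each block by its sum. The coefficient $c_\alpha^\beta$ is the product of $1/(O!\,E!)$ over the blocks, where $O$ and $E$ are the numbers of odd and even parts of the block. Let $V$ be a graded vector space with a basis $(v_i)_{i\in I}$ of homogeneous elements of positive degree. The shuffle algebra $\mathrm{S}(V)=\bigoplus_{n\ge0}V^{\otimes n}$ has as basis the words $v_\alpha=v_{\alpha_1}\cdots v_{\alpha_\ell}$ in the letters $v_i$. Its product is the shuffle product and its coproduct is deconcatenation. It is graded by $\deg v_\alpha=\sum_j\deg v_{\alpha_j}$, and we assume that for each $n$ only finitely many words have degree $n$. Let $\Phi_{\mathrm{S}(V)}:\mathrm{S}(V)\to\mathrm{QSym}$ be the linear map $v_\alpha\mapsto S_{(\deg v_{\alpha_1},\dots,\deg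 v_{\alpha_\ell})}$ and let $\zeta_{\mathrm{S}(V)}=\zeta_{\mathrm{QSym}}\circ\Phi_{\mathrm{S}(V)}$. Call $v_\alpha$ odd if all its letters have odd degree, and let $\mathrm{S}(\mathrm{O}(V))$ be the span of the odd words. Let $\Theta_{\mathrm{S}(V)}:\mathrm{S}(V)\to\mathrm{S}(V)$ be the linear map with $\Theta_{\mathrm{S}(V)}(v_\alpha)=2^{\ell(\alpha)}v_\alpha$ if $v_\alpha$ is odd and $\Theta_{\mathrm{S}(V)}(v_\alpha)=0$ otherwise. Theorem. The map $\Theta_{\mathrm{S}(V)}$ is a graded Hopf morphism with image $\mathrm{S}(\mathrm{O}(V))$. The map $\Theta_{\mathrm{QSym}}$ exists, and $$\Phi_{\mathrm{S}(V)}\circ\Theta_{\mathrm{S}(V)}=\Theta_{\mathrm{QSym}}\circ\Phi_{\mathrm{S}(V)},\qquad \Phi_{\mathrm{S}(V)}(\mathrm{S}(\mathrm{O}(V)))\subseteq\Pi.$$ Moreover, $(\mathrm{S}(V),\zeta_{\mathrm{S}(V)})$ is a combinatorial Hopf algebra and $\Phi_{\mathrm{S}(V)}$ is its unique morphism to $(\mathrm{QSym},\zeta_{\mathrm{QSym}})$.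 Hence $\Theta_{\mathrm{S}(V)}$ is a theta map for $(\mathrm{S}(V),\zeta_{\mathrm{S}(V)})$, and $\mathrm{S}(\mathrm{O}(V))$ is a peak algebra for it. -/

import Mathlib

open scoped TensorProduct

universe u

noncomputable section

/-- A commutative and associative partial law for contracting two adjacent letters that come from
different words of a quasi-shuffle; `none` means that the two letters are not contracted. -/
class IsContraction {A : Type u} (d : A → A → Option A) : Prop where
  comm : ∀ a b, d a b = d b a
  assoc : ∀ a b c, (d a b).bind (fun e => d e c) = (d b c).bind (fun e => d a e)

/-- The multiset of quasi-shuffles of two words. A quasi-shuffle starts with the first letter of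
one of the words, or with the contraction of both first letters if these can be contracted. If no
letters can be contracted, these are the shuffles of the two words. -/
def quasiShuffle {A : Type u} (d : A → A → Option A) : List A → List A → Multiset (List A)
  | [], v => {v}
  | a :: u, [] => {a :: u}
  | a :: u, b :: v =>
      (quasiShuffle d u (b :: v)).map (fun w => a :: w) +
      (quasiShuffle d (a :: u) v).map (fun w => b :: w) +
      (d a b).elim 0 (fun c => (quasiShuffle d u v).map (fun w => c :: w))
termination_by u v => u.length + v.length

/-- The complex vector space with basis the words on the alphabet `A`. Below it is made into a Hopf
algebra with the quasi-shuffle product and the deconcatenation coproduct. -/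
def QuasiShuffle {A : Type u} (_d : A → A → Option A) : Type u := List A →₀ ℂ

namespace QuasiShuffle

variable {A : Type u} {d : A → A → Option A}

instance instAddCommGroup : AddCommGroup (QuasiShuffle d) :=
  inferInstanceAs (AddCommGroup (List A →₀ ℂ))

instance instModule : Module ℂ (QuasiShuffle d) := inferInstanceAs (Module ℂ (List A →₀ ℂ))

/-- The basis of words. -/
def wordBasis (d : A → A → Option A) : Module.Basis (List A) ℂ (QuasiShuffle d) :=
  Module.Basis.ofRepr (LinearEquiv.refl ℂ (List A →₀ ℂ))

/-- The basis element attached to a word. -/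
def word (d : A → A → Option A) (w : List A) : QuasiShuffle d := wordBasis d w

/-- The linear map with prescribed values on words. -/
def lift {M : Type*} [AddCommGroup M] [Module ℂ M] (f : List A → M) : QuasiShuffle d →ₗ[ℂ] M :=
  (wordBasis d).constr ℂ f

@[simp] theorem lift_word {M : Type*} [AddCommGroup M] [Module ℂ M] (f : List A → M)
    (w : List A) : lift f (word d w) = f w :=
  (wordBasis d).constr_basis ℂ f w

theorem hom_ext {M : Type*} [AddCommGroup M] [Module ℂ M] {f g : QuasiShuffle d →ₗ[ℂ] M}
    (h : ∀ w, f (word d w) = g (word d w)) : f = g :=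
  (wordBasis d).ext h

theorem word_induction {p : QuasiShuffle d → Prop} (x : QuasiShuffle d) (h0 : p 0)
    (hw : ∀ w, p (word d w)) (hadd : ∀ x y, p x → p y → p (x + y))
    (hsmul : ∀ (c : ℂ) x, p x → p (c • x)) : p x := by
  have hx : x ∈ Submodule.span ℂ (Set.range (wordBasis d)) := by
    rw [(wordBasis d).span_eq]; trivial
  induction hx using Submodule.span_induction with
  | mem x h => obtain ⟨w, rfl⟩ := h; exact hw w
  | zero => exact h0
  | add x y _ _ hx hy => exact hadd x y hx hy
  | smul c x _ hx => exact hsmul c x hx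

/-! ### Product -/

/-- `u * v = ∑ w`, the sum running over the multiset of quasi-shuffles `w` of `u` and `v`. -/
def mulMap (d : A → A → Option A) : QuasiShuffle d →ₗ[ℂ] QuasiShuffle d →ₗ[ℂ] QuasiShuffle d :=
  lift fun u => lift fun v => ((quasiShuffle d u v).map (word d)).sum

instance instMul : Mul (QuasiShuffle d) := ⟨fun x y => mulMap d x y⟩

instance instOne : One (QuasiShuffle d) := ⟨word d []⟩

theorem mul_def (x y : QuasiShuffle d) : x * y = mulMap d x y := rfl

theorem one_def : (1 : QuasiShuffle d) = word d [] := rfl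

theorem word_mul_word (u v : List A) :
    word d u * word d v = ((quasiShuffle d u v).map (word d)).sum := by
  simp [mul_def, mulMap]

/-- Put a letter in front of every word (`none` gives the zero map). -/
def prep (d : A → A → Option A) (o : Option A) : QuasiShuffle d →ₗ[ℂ] QuasiShuffle d :=
  o.elim 0 (fun a => lift fun w => word d (a :: w))

@[simp] theorem prep_none : prep d none = 0 := rfl

@[simp] theorem prep_some_word (a : A) (w : List A) :
    prep d (some a) (word d w) = word d (a :: w) := by
  simp [prep]

/-- Contraction of optional letters. -/
def dOpt (d : A → A → Option A) (o p : Option A) : Option A := o.bind fun a => p.bind fun b => d a b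

theorem add_mul' (x y z : QuasiShuffle d) : (x + y) * z = x * z + y * z := by
  simp [mul_def]

theorem mul_add' (x y z : QuasiShuffle d) : x * (y + z) = x * y + x * z := by
  simp [mul_def]

theorem smul_mul' (c : ℂ) (x y : QuasiShuffle d) : (c • x) * y = c • (x * y) := by
  simp [mul_def]

theorem mul_smul' (c : ℂ) (x y : QuasiShuffle d) : x * (c • y) = c • (x * y) := by
  simp [mul_def]

theorem zero_mul' (x : QuasiShuffle d) : 0 * x = 0 := by
  simp [mul_def]

theorem mul_zero' (x : QuasiShuffle d) : x * 0 = 0 := by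
  simp [mul_def]

theorem one_mul' (x : QuasiShuffle d) : 1 * x = x := by
  have : mulMap d 1 = LinearMap.id := hom_ext fun w => by
    simp [one_def, mulMap, quasiShuffle]
  simp [mul_def, this]

theorem mul_one' (x : QuasiShuffle d) : x * 1 = x := by
  have : (mulMap d).flip 1 = LinearMap.id := hom_ext fun w => by
    cases w <;> simp [one_def, mulMap, quasiShuffle]
  exact LinearMap.congr_fun this x

theorem word_mul_nil (w : List A) : word d w * word d [] = word d w := mul_one' _

theorem cons_mul_cons_word (a b : A) (u v : List A) :
    prep d (some a) (word d u) * prep d (some b) (word d v) =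
      prep d (some a) (word d u * prep d (some b) (word d v)) +
      prep d (some b) (prep d (some a) (word d u) * word d v) +
      prep d (d a b) (word d u * word d v) := by
  simp only [prep_some_word, word_mul_word]
  rw [quasiShuffle]
  simp only [Multiset.map_add, Multiset.sum_add, map_multiset_sum, Multiset.map_map,
    Function.comp_def, prep_some_word]
  congr 1
  cases d a b <;> simp [Multiset.map_map]

theorem cons_mul_cons (o p : Option A) (x y : QuasiShuffle d) :
    prep d o x * prep d p y =
      prep d o (x * prep d p y) + prep d p (prep d o x * y) + prep d (dOpt d o p) (x * y) := by
  cases o with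
  | none => simp [zero_mul', dOpt]
  | some a =>
    cases p with
    | none => simp [mul_zero', dOpt]
    | some b =>
      induction x using word_induction with
      | h0 => simp [zero_mul']
      | hadd x x' h h' => simp only [map_add, add_mul', h, h']; abel
      | hsmul c x h => simp only [map_smul, smul_mul', h, smul_add]
      | hw u =>
        induction y using word_induction with
        | h0 => simp [mul_zero']
        | hadd y y' h h' => simp only [map_add, mul_add', h, h']; abel
        | hsmul c y h => simp only [map_smul, mul_smul', h, smul_add]
        | hw v => exact cons_mul_cons_word a b u v

/-! ### Coproduct -/

/-- Deconcatenation: `Δ(w) = ∑ w' ⊗ w''` over all factorizations `w = w' w''`. -/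
def comulMap (d : A → A → Option A) :
    QuasiShuffle d →ₗ[ℂ] QuasiShuffle d ⊗[ℂ] QuasiShuffle d :=
  lift fun w => ∑ i ∈ Finset.range (w.length + 1), word d (w.take i) ⊗ₜ[ℂ] word d (w.drop i)

/-- The counit: the coefficient of the empty word. -/
def counitMap (d : A → A → Option A) : QuasiShuffle d →ₗ[ℂ] ℂ :=
  lift fun w => if w = [] then 1 else 0

theorem comul_word (w : List A) : comulMap d (word d w) =
    ∑ i ∈ Finset.range (w.length + 1), word d (w.take i) ⊗ₜ[ℂ] word d (w.drop i) := by
  simp [comulMap]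

theorem counit_prep (o : Option A) (x : QuasiShuffle d) : counitMap d (prep d o x) = 0 := by
  have : counitMap d ∘ₗ prep d o = 0 := hom_ext fun w => by cases o <;> simp [counitMap]
  exact LinearMap.congr_fun this x

theorem counit_one' : counitMap d 1 = 1 := by
  simp [one_def, counitMap]

/-! ### The bialgebra axioms -/

variable [hd : IsContraction d]

theorem dOpt_comm (o p : Option A) : dOpt d o p = dOpt d p o := by
  cases o <;> cases p <;> simp [dOpt, hd.comm]

theorem dOpt_assoc (o p q : Option A) : dOpt d (dOpt d o p) q = dOpt d o (dOpt d p q) := by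
  cases o with
  | none => simp [dOpt]
  | some a =>
    cases p with
    | none => simp [dOpt]
    | some b =>
      cases q with
      | none => simp [dOpt]
      | some c => simpa [dOpt] using hd.assoc a b c

theorem word_mul_comm : (u v : List A) → word d u * word d v = word d v * word d u
  | [], v => by rw [← one_def, one_mul', mul_one']
  | a :: u, [] => by rw [← one_def, one_mul', mul_one']
  | a :: u, b :: v => by
    have h1 := word_mul_comm u (b :: v)
    have h2 := word_mul_comm (a :: u) v
    have h3 := word_mul_comm u v
    simp only [← prep_some_word] at h1 h2 ⊢
    rw [cons_mul_cons, cons_mul_cons, h1, h2, h3, dOpt_comm]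
    abel
termination_by u v => u.length + v.length

theorem word_mul_assoc : (u v w : List A) →
    word d u * word d v * word d w = word d u * (word d v * word d w)
  | [], v, w => by rw [← one_def, one_mul', one_mul']
  | a :: u, [], w => by rw [← one_def, one_mul', mul_one']
  | a :: u, b :: v, [] => by rw [← one_def, mul_one', mul_one']
  | a :: u, b :: v, c :: w => by
    have h1 := word_mul_assoc u (b :: v) (c :: w)
    have h2 := word_mul_assoc (a :: u) v (c :: w)
    have h3 := word_mul_assoc (a :: u) (b :: v) w
    have h4 := word_mul_assoc u v (c :: w)
    have h5 := word_mul_assoc u (b :: v) w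
    have h6 := word_mul_assoc (a :: u) v w
    have h7 := word_mul_assoc u v w
    simp only [← prep_some_word] at h1 h2 h3 h4 h5 h6 ⊢
    generalize word d u = x at *
    generalize word d v = y at *
    generalize word d w = z at *
    have h3' := congrArg (prep d (some c)) h3
    rw [cons_mul_cons (some a) (some b) x y] at h3'
    have h1' := congrArg (prep d (some a)) h1
    rw [cons_mul_cons (some b) (some c) y z] at h1'
    simp only [add_mul', mul_add', map_add] at h3' h1'
    have key : ∀ p q r s t l m n : QuasiShuffle d, ∀ l1 l2 l3 r1 r2 r3 : QuasiShuffle d,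
        l = r1 + r2 + r3 → l1 + l2 + l3 = r →
        l + l1 + p + (q + l2 + s) + (t + l3 + m) =
          r1 + q + t + (r2 + r + p) + (r3 + s + m) := by
      intro p q r s t l m n l1 l2 l3 r1 r2 r3 e1 e2
      rw [e1, ← e2]; abel
    rw [cons_mul_cons (some a) (some b) x y, cons_mul_cons (some b) (some c) y z]
    simp only [add_mul', mul_add']
    rw [cons_mul_cons (some a) (some c), cons_mul_cons (some b) (some c),
      cons_mul_cons (dOpt d (some a) (some b)) (some c), cons_mul_cons (some a) (some b),
      cons_mul_cons (some a) (some c), cons_mul_cons (some a) (dOpt d (some b) (some c)),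
      dOpt_assoc, h2, h4, h7, h5, h6]
    exact key _ _ _ _ _ _ _ 0 _ _ _ _ _ _ h1' h3'
termination_by u v w => u.length + v.length + w.length

theorem mul_comm' (x y : QuasiShuffle d) : x * y = y * x := by
  have : mulMap d = (mulMap d).flip := hom_ext fun u => hom_ext fun v => word_mul_comm u v
  exact LinearMap.congr_fun (LinearMap.congr_fun this x) y

theorem mul_assoc' (x y z : QuasiShuffle d) : x * y * z = x * (y * z) := by
  induction x using word_induction with
  | h0 => simp [zero_mul']
  | hadd x x' h h' => simp only [add_mul', h, h']
  | hsmul c x h => simp only [smul_mul', h]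
  | hw u =>
    induction y using word_induction with
    | h0 => simp [zero_mul', mul_zero']
    | hadd y y' h h' => simp only [add_mul', mul_add', h, h']
    | hsmul c y h => simp only [smul_mul', mul_smul', h]
    | hw v =>
      induction z using word_induction with
      | h0 => simp [mul_zero']
      | hadd z z' h h' => simp only [mul_add', h, h']
      | hsmul c z h => simp only [mul_smul', h]
      | hw w => exact word_mul_assoc u v w

instance instCommRing : CommRing (QuasiShuffle d) :=
  { instAddCommGroup, instMul, instOne with
    left_distrib := mul_add'
    right_distrib := add_mul'
    zero_mul := zero_mul'
    mul_zero := mul_zero'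
    mul_assoc := mul_assoc'
    one_mul := one_mul'
    mul_one := mul_one'
    mul_comm := mul_comm' }

instance instAlgebra : Algebra ℂ (QuasiShuffle d) :=
  Algebra.ofModule smul_mul' (fun c x y => mul_smul' c x y)

theorem comul_prep (o : Option A) (x : QuasiShuffle d) :
    comulMap d (prep d o x) = 1 ⊗ₜ prep d o x + (prep d o).rTensor _ (comulMap d x) := by
  cases o with
  | none => simp
  | some a =>
    induction x using word_induction with
    | h0 => simp
    | hadd x x' h h' => simp only [map_add, h, h', TensorProduct.tmul_add]; abel
    | hsmul c x h => simp only [map_smul, h, smul_add, TensorProduct.tmul_smul]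
    | hw w =>
      rw [prep_some_word, comul_word, comul_word, List.length_cons, Finset.sum_range_succ']
      simp [one_def, add_comm]

theorem comul_one' : comulMap d 1 = 1 := by
  simp [one_def, comul_word, Algebra.TensorProduct.one_def]

theorem rTensor_mul (a b : Option A) (X Y : QuasiShuffle d ⊗[ℂ] QuasiShuffle d) :
    (prep d a).rTensor _ X * (prep d b).rTensor _ Y =
      (prep d a).rTensor _ (X * (prep d b).rTensor _ Y) +
      (prep d b).rTensor _ ((prep d a).rTensor _ X * Y) +
      (prep d (dOpt d a b)).rTensor _ (X * Y) := by
  induction X using TensorProduct.induction_on with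
  | zero => simp
  | add X X' h h' => simp only [map_add, add_mul, h, h']; abel
  | tmul x x' =>
    induction Y using TensorProduct.induction_on with
    | zero => simp
    | add Y Y' h h' => simp only [map_add, mul_add, h, h']; abel
    | tmul y y' =>
      simp only [LinearMap.rTensor_tmul, Algebra.TensorProduct.tmul_mul_tmul]
      rw [cons_mul_cons, TensorProduct.add_tmul, TensorProduct.add_tmul]

theorem rTensor_mul_one_tmul (a : Option A) (X : QuasiShuffle d ⊗[ℂ] QuasiShuffle d)
    (z : QuasiShuffle d) :
    (prep d a).rTensor _ X * (1 ⊗ₜ z) = (prep d a).rTensor _ (X * (1 ⊗ₜ z)) := by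
  induction X using TensorProduct.induction_on with
  | zero => simp
  | add X X' h h' => simp only [map_add, add_mul, h, h']
  | tmul x x' => simp

theorem word_comul_mul : (u v : List A) →
    comulMap d (word d u * word d v) = comulMap d (word d u) * comulMap d (word d v)
  | [], v => by rw [← one_def, comul_one', one_mul, one_mul]
  | a :: u, [] => by rw [← one_def, comul_one', mul_one, mul_one]
  | a :: u, b :: v => by
    have h1 := word_comul_mul u (b :: v)
    have h2 := word_comul_mul (a :: u) v
    have h3 := word_comul_mul u v
    simp only [← prep_some_word] at h1 h2 ⊢
    generalize word d u = x at *
    generalize word d v = y at *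
    have e : (1 : QuasiShuffle d) ⊗ₜ[ℂ] (prep d (some a) x * prep d (some b) y) =
        (1 ⊗ₜ prep d (some a) x) * (1 ⊗ₜ prep d (some b) y) := by simp
    have e' := cons_mul_cons (some a) (some b) x y
    rw [e']
    simp only [map_add]
    rw [comul_prep (some a) (x * _), comul_prep (some b) (_ * y), comul_prep (dOpt d _ _), h1, h2,
      h3]
    have e2 : ∀ p q r s t k : QuasiShuffle d ⊗[ℂ] QuasiShuffle d,
        p + q + (r + s) + (t + k) = (p + r + t) + (q + s + k) := by intros; abel
    rw [e2, ← TensorProduct.tmul_add, ← TensorProduct.tmul_add, ← e', e,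
      comul_prep (some a) x, comul_prep (some b) y]
    simp only [mul_add, add_mul, map_add]
    rw [rTensor_mul, mul_comm (1 ⊗ₜ[ℂ] prep d (some a) x) ((prep d (some b)).rTensor _ _),
      rTensor_mul_one_tmul, rTensor_mul_one_tmul,
      mul_comm (comulMap d y) (1 ⊗ₜ[ℂ] prep d (some a) x)]
    abel
termination_by u v => u.length + v.length

theorem word_counit_mul : (u v : List A) →
    counitMap d (word d u * word d v) = counitMap d (word d u) * counitMap d (word d v)
  | [], v => by rw [← one_def, counit_one', one_mul, one_mul]
  | a :: u, [] => by rw [← one_def, counit_one', mul_one, mul_one]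
  | a :: u, b :: v => by
    simp only [← prep_some_word]
    rw [cons_mul_cons, map_add, map_add, counit_prep, counit_prep, counit_prep, counit_prep]
    simp

theorem comul_mul' (x y : QuasiShuffle d) :
    comulMap d (x * y) = comulMap d x * comulMap d y := by
  induction x using word_induction with
  | h0 => simp
  | hadd x x' h h' => simp only [add_mul, map_add, h, h']
  | hsmul c x h => simp only [smul_mul_assoc, map_smul, h]
  | hw u =>
    induction y using word_induction with
    | h0 => simp
    | hadd y y' h h' => simp only [mul_add, map_add, h, h']
    | hsmul c y h => simp only [mul_smul_comm, map_smul, h]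
    | hw v => exact word_comul_mul u v

theorem counit_mul' (x y : QuasiShuffle d) :
    counitMap d (x * y) = counitMap d x * counitMap d y := by
  induction x using word_induction with
  | h0 => simp
  | hadd x x' h h' => simp only [add_mul, map_add, h, h']
  | hsmul c x h => simp only [smul_mul_assoc, map_smul, h]
  | hw u =>
    induction y using word_induction with
    | h0 => simp
    | hadd y y' h h' => simp only [mul_add, map_add, h, h']
    | hsmul c y h => simp only [mul_smul_comm, map_smul, h]
    | hw v => exact word_counit_mul u v

set_option synthInstance.maxHeartbeats 200000 in
theorem assoc_rTensor_comul_prep (o : Option A) (X : QuasiShuffle d ⊗[ℂ] QuasiShuffle d) :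
    TensorProduct.assoc ℂ _ _ _ ((comulMap d).rTensor _ ((prep d o).rTensor _ X)) =
      1 ⊗ₜ (prep d o).rTensor _ X +
      (prep d o).rTensor _ (TensorProduct.assoc ℂ _ _ _ ((comulMap d).rTensor _ X)) := by
  induction X using TensorProduct.induction_on with
  | zero => simp
  | add X X' h h' => simp only [map_add, h, h', TensorProduct.tmul_add]; abel
  | tmul x x' =>
    simp only [LinearMap.rTensor_tmul, comul_prep, TensorProduct.add_tmul, map_add,
      TensorProduct.assoc_tmul]
    congr 1
    generalize comulMap d x = Y
    induction Y using TensorProduct.induction_on with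
    | zero => simp
    | add Y Y' h h' => simp only [map_add, h, h', TensorProduct.add_tmul]
    | tmul y y' => simp

instance instCoalgebra : Coalgebra ℂ (QuasiShuffle d) where
  comul := comulMap d
  counit := counitMap d
  coassoc := hom_ext fun w => by
    simp only [LinearMap.comp_apply, LinearEquiv.coe_coe]
    induction w with
    | nil => simp [← one_def, comul_one', Algebra.TensorProduct.one_def]
    | cons a w ih =>
      rw [← prep_some_word, comul_prep, map_add, map_add, assoc_rTensor_comul_prep, ih, map_add,
        LinearMap.lTensor_tmul, comul_prep, LinearMap.rTensor_tmul, comul_one',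
        Algebra.TensorProduct.one_def, TensorProduct.assoc_tmul, TensorProduct.tmul_add, add_assoc]
      congr 2
      exact LinearMap.congr_fun ((LinearMap.rTensor_comp_lTensor _ _ _).trans
        (LinearMap.lTensor_comp_rTensor _ _ _).symm) _
  rTensor_counit_comp_comul := hom_ext fun w => by
    simp only [LinearMap.comp_apply]
    cases w with
    | nil => simp [← one_def, comul_one', counit_one', Algebra.TensorProduct.one_def]
    | cons a w =>
      have h : counitMap d ∘ₗ prep d (some a) = 0 := LinearMap.ext fun x => counit_prep _ x
      rw [← prep_some_word, comul_prep, map_add, ← LinearMap.comp_apply (LinearMap.rTensor _ _),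
        ← LinearMap.rTensor_comp, h]
      simp [counit_one']
  lTensor_counit_comp_comul := hom_ext fun w => by
    simp only [LinearMap.comp_apply]
    induction w with
    | nil => simp [← one_def, comul_one', counit_one', Algebra.TensorProduct.one_def]
    | cons a w ih =>
      rw [← prep_some_word, comul_prep, map_add, LinearMap.lTensor_tmul, counit_prep,
        ← LinearMap.comp_apply, LinearMap.lTensor_comp_rTensor, ← LinearMap.rTensor_comp_lTensor,
        LinearMap.comp_apply, ih]
      simp

theorem comul_def (x : QuasiShuffle d) : Coalgebra.comul (R := ℂ) x = comulMap d x := rfl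

theorem counit_def (x : QuasiShuffle d) : Coalgebra.counit (R := ℂ) x = counitMap d x := rfl

instance instBialgebra : Bialgebra ℂ (QuasiShuffle d) :=
  Bialgebra.mk' ℂ (QuasiShuffle d) counit_one' (fun {x y} => counit_mul' x y) comul_one'
    (fun {x y} => comul_mul' x y)

/-! ### Antipode -/

/-- Left convolution inverse of the identity, by recursion on the length of words. -/
def leftInvWord (d : A → A → Option A) : List A → QuasiShuffle d
  | [] => word d []
  | a :: u => - ∑ i : Fin (u.length + 1),
      mulMap d (leftInvWord d ((a :: u).take i)) (word d ((a :: u).drop i))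
termination_by w => w.length
decreasing_by simp; omega

/-- Right convolution inverse of the identity, by recursion on the length of words. -/
def rightInvWord (d : A → A → Option A) : List A → QuasiShuffle d
  | [] => word d []
  | a :: u => - ∑ i : Fin (u.length + 1),
      mulMap d (word d (a :: u.take i)) (rightInvWord d (u.drop i))
termination_by w => w.length
decreasing_by simp

theorem conv_apply_word (f g : QuasiShuffle d →ₗ[ℂ] QuasiShuffle d) (w : List A) :
    (WithConv.toConv f * WithConv.toConv g) (word d w) =
      ∑ i ∈ Finset.range (w.length + 1), f (word d (w.take i)) * g (word d (w.drop i)) := by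
  rw [LinearMap.convMul_apply, comul_def, comul_word]
  simp

theorem one_conv_word (w : List A) :
    (1 : WithConv (QuasiShuffle d →ₗ[ℂ] QuasiShuffle d)) (word d w) =
      if w = [] then 1 else 0 := by
  rw [LinearMap.convOne_apply, counit_def, counitMap, lift_word]
  split_ifs <;> simp

theorem left_conv : WithConv.toConv (lift (leftInvWord d)) * WithConv.toConv LinearMap.id =
    (1 : WithConv (QuasiShuffle d →ₗ[ℂ] QuasiShuffle d)) := by
  apply WithConv.ext
  refine hom_ext fun w => ?_
  change (WithConv.toConv _ * WithConv.toConv _ :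
    WithConv (QuasiShuffle d →ₗ[ℂ] QuasiShuffle d)) (word d w) = _
  refine Eq.trans ?_ (one_conv_word w).symm
  rw [conv_apply_word]
  cases w with
  | nil => simp [lift_word, leftInvWord, one_def, (word_mul_nil [])]
  | cons a u =>
    rw [Finset.sum_range_succ, List.length_cons, ← List.length_cons (a := a), List.take_length,
      List.drop_length, lift_word, leftInvWord]
    simp [Finset.sum_range, ← one_def, mul_def]

theorem right_conv : WithConv.toConv LinearMap.id * WithConv.toConv (lift (rightInvWord d)) =
    (1 : WithConv (QuasiShuffle d →ₗ[ℂ] QuasiShuffle d)) := by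
  apply WithConv.ext
  refine hom_ext fun w => ?_
  change (WithConv.toConv _ * WithConv.toConv _ :
    WithConv (QuasiShuffle d →ₗ[ℂ] QuasiShuffle d)) (word d w) = _
  refine Eq.trans ?_ (one_conv_word w).symm
  rw [conv_apply_word]
  cases w with
  | nil => simp [lift_word, rightInvWord, one_def, (word_mul_nil [])]
  | cons a u =>
    rw [Finset.sum_range_succ', List.take_zero, List.drop_zero, lift_word]
    rw [show rightInvWord d (a :: u) = _ from rightInvWord.eq_2 d a u]
    simp [Finset.sum_range, ← one_def, mul_def]

theorem id_conv_left : WithConv.toConv LinearMap.id * WithConv.toConv (lift (leftInvWord d)) =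
    (1 : WithConv (QuasiShuffle d →ₗ[ℂ] QuasiShuffle d)) := by
  rw [left_inv_eq_right_inv left_conv right_conv]
  exact right_conv

instance instHopfAlgebra : HopfAlgebra ℂ (QuasiShuffle d) :=
  HopfAlgebra.ofConvInverse (lift (leftInvWord d)) left_conv id_conv_left

theorem map_mul_of_word {R : Type*} [CommRing R] [Algebra ℂ R] (f : QuasiShuffle d →ₗ[ℂ] R)
    (h1 : f 1 = 1)
    (h : ∀ (a : A) (u : List A) (b : A) (v : List A),
      f (word d u * word d (b :: v)) = f (word d u) * f (word d (b :: v)) →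
      f (word d (a :: u) * word d v) = f (word d (a :: u)) * f (word d v) →
      f (word d u * word d v) = f (word d u) * f (word d v) →
      f (word d (a :: u) * word d (b :: v)) = f (word d (a :: u)) * f (word d (b :: v)))
    (x y : QuasiShuffle d) : f (x * y) = f x * f y := by
  have hw : ∀ n (u v : List A), u.length + v.length ≤ n →
      f (word d u * word d v) = f (word d u) * f (word d v) := by
    intro n
    induction n with
    | zero =>
      intro u v huv
      have hu : u = [] := List.length_eq_zero_iff.mp (by omega)
      rw [hu, ← one_def, h1, one_mul, one_mul]
    | succ n ih =>
      intro u v huv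
      match u, v, huv with
      | [], v, _ => rw [← one_def, h1, one_mul, one_mul]
      | a :: u, [], _ => rw [← one_def, h1, mul_one, mul_one]
      | a :: u, b :: v, huv =>
        simp only [List.length_cons] at huv
        exact h a u b v (ih _ _ (by simp; omega)) (ih _ _ (by simp; omega)) (ih _ _ (by omega))
  induction x using word_induction with
  | h0 => simp
  | hadd x x' h h' => simp only [add_mul, map_add, h, h']
  | hsmul c x h => simp only [smul_mul_assoc, map_smul, h]
  | hw u =>
    induction y using word_induction with
    | h0 => simp
    | hadd y y' h h' => simp only [mul_add, map_add, h, h']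
    | hsmul c y h => simp only [mul_smul_comm, map_smul, h]
    | hw v => exact hw _ u v le_rfl

/-- If the letter `a` has degree `wt a`, then the homogeneous elements of degree `n` are the
combinations of words whose letters have degrees with sum `n`. -/
def grading (d : A → A → Option A) (wt : A → ℕ) (n : ℕ) : Submodule ℂ (QuasiShuffle d) :=
  Submodule.span ℂ (word d '' {w | (w.map wt).sum = n})

end QuasiShuffle

/-! ### Quasisymmetric functions -/

/-- Addition of two parts of compositions. -/
def addParts (a b : ℕ+) : Option ℕ+ := some (a + b)

instance : IsContraction addParts where
  comm a b := by simp [addParts, add_comm]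
  assoc a b c := by simp [addParts, add_assoc]

/-- The Hopf algebra of quasisymmetric functions over `ℂ`, presented by its monomial basis `M_α`
(indexed by compositions `α`, i.e. words of positive integers), the quasi-shuffle product
`M_α M_β = ∑ M_γ` and the deconcatenation coproduct. -/
abbrev QSym : Type := QuasiShuffle addParts

namespace QSym

open QuasiShuffle

/-- The monomial quasisymmetric function `M_α`. -/
def M (α : List ℕ+) : QSym := word addParts α

/-- The grading of `QSym`: the degree of `M_α` is the sum of the parts of `α`. -/
def grading : ℕ → Submodule ℂ QSym := QuasiShuffle.grading addParts PNat.val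

/-- Values on the monomial basis of the evaluation `f ↦ f(x, 0, 0, …)`. -/
def evalOneWord {R : Type*} [CommRing R] (x : R) : List ℕ+ → R
  | [] => 1
  | [a] => x ^ (a : ℕ)
  | _ :: _ :: _ => 0

theorem lift_evalOneWord_prep {R : Type*} [CommRing R] [Algebra ℂ R] (x : R) (a : ℕ+) (f : QSym) :
    lift (evalOneWord x) (prep addParts (some a) f) =
      x ^ (a : ℕ) * algebraMap ℂ R (counitMap addParts f) := by
  have : lift (evalOneWord x) ∘ₗ prep addParts (some a) =
      LinearMap.mulLeft ℂ (x ^ (a : ℕ)) ∘ₗ Algebra.linearMap ℂ R ∘ₗ counitMap addParts :=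
    hom_ext fun w => by cases w <;> simp [evalOneWord, counitMap]
  exact LinearMap.congr_fun this f

/-- The algebra morphism `f ↦ f(x, 0, 0, …)`: it maps `M_()` to `1`, `M_(a)` to `x ^ a` and `M_α`
to `0` if `α` has at least two parts. -/
def evalOne {R : Type*} [CommRing R] [Algebra ℂ R] (x : R) : QSym →ₐ[ℂ] R :=
  AlgHom.ofLinearMap (lift (evalOneWord x)) (by simp [one_def, evalOneWord])
    (map_mul_of_word _ (by simp [one_def, evalOneWord]) fun a u b v _ _ _ => by
      simp only [← prep_some_word]
      rw [cons_mul_cons]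
      simp only [map_add, dOpt, addParts, Option.bind_some, lift_evalOneWord_prep]
      rw [counit_mul', counit_mul', counit_mul', counit_prep, counit_prep, PNat.add_coe, pow_add,
        map_mul, map_mul, map_mul]
      simp only [map_zero, mul_zero, zero_mul, zero_add]
      ring)

@[simp] theorem evalOne_M {R : Type*} [CommRing R] [Algebra ℂ R] (x : R) (α : List ℕ+) :
    evalOne x (M α) = evalOneWord x α :=
  lift_word _ _

/-- The canonical character `ζ(f) = f(1, 0, 0, …)` of `QSym`. -/
def zeta : QSym →ₐ[ℂ] ℂ := evalOne 1

theorem zeta_M (α : List ℕ+) : zeta (M α) = if α.length ≤ 1 then 1 else 0 := by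
  rw [zeta, evalOne_M]
  match α with
  | [] => simp [evalOneWord]
  | [a] => simp [evalOneWord]
  | a :: b :: u => simp [evalOneWord]

/-- Evaluation `f ↦ f(x_1, …, x_n, 0, 0, …)` of quasisymmetric functions. That this is an algebra
morphism with the recursion stated below, which characterizes
`M_α = ∑_{i_1 < ⋯ < i_ℓ} x_{i_1}^{α_1} ⋯ x_{i_ℓ}^{α_ℓ}`, says that the quasi-shuffle product is the
product of power series. -/
def evalList {R : Type*} [CommRing R] [Algebra ℂ R] : List R → (QSym →ₐ[ℂ] R)
  | [] => (Algebra.ofId ℂ R).comp (Bialgebra.counitAlgHom ℂ QSym)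
  | x :: xs => (WithConv.toConv (evalOne x) * WithConv.toConv (evalList xs)).ofConv

theorem evalList_nil_M {R : Type*} [CommRing R] [Algebra ℂ R] (α : List ℕ+) :
    evalList ([] : List R) (M α) = if α = [] then 1 else 0 := by
  simp only [evalList, AlgHom.comp_apply, Bialgebra.counitAlgHom_apply, counit_def, counitMap, M,
    lift_word]
  split_ifs <;> simp

theorem evalList_M_nil {R : Type*} [CommRing R] [Algebra ℂ R] (xs : List R) :
    evalList xs (M []) = 1 := map_one (evalList xs)

theorem evalList_cons_M_cons {R : Type*} [CommRing R] [Algebra ℂ R] (x : R) (xs : List R)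
    (a : ℕ+) (α : List ℕ+) :
    evalList (x :: xs) (M (a :: α)) =
      evalList xs (M (a :: α)) + x ^ (a : ℕ) * evalList xs (M α) := by
  have h : evalList (x :: xs) (M (a :: α)) = Algebra.TensorProduct.lift (evalOne x) (evalList xs)
      (fun _ _ => Commute.all _ _) (comulMap addParts (word addParts (a :: α))) :=
    AlgHom.convMul_apply (WithConv.toConv (evalOne x)) (WithConv.toConv (evalList xs)) _
  rw [h, comul_word, map_sum, List.length_cons, Finset.sum_range_succ', Finset.sum_range_succ',
    Finset.sum_eq_zero]
  · simp only [Algebra.TensorProduct.lift_tmul]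
    change 0 + evalOne x (M [a]) * evalList xs (M α) + evalOne x (M []) * evalList xs (M _) = _
    simp only [evalOne_M, evalOneWord, List.drop_zero]
    ring
  · intro i hi
    obtain _ | ⟨b, β⟩ := α
    · simp at hi
    · simp only [Algebra.TensorProduct.lift_tmul, List.take_succ_cons]
      change evalOne x (M (a :: b :: β.take i)) * _ = 0
      simp [evalOneWord]

/-- The algebra automorphism multiplying the homogeneous elements of degree `n` by `(-1) ^ n`. -/
def sign : QSym →ₐ[ℂ] QSym :=
  AlgHom.ofLinearMap (lift fun α : List ℕ+ => (-1 : ℂ) ^ (α.map PNat.val).sum • M α)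
    (by simp [one_def, M])
    (map_mul_of_word _ (by simp [one_def, M]) fun a u b v h1 h2 h3 => by
      have key : ∀ (a : ℕ+) (f : QSym),
          lift (fun α : List ℕ+ => (-1 : ℂ) ^ (α.map PNat.val).sum • M α)
            (prep addParts (some a) f) = (-1 : ℂ) ^ (a : ℕ) • prep addParts (some a)
              (lift (fun α : List ℕ+ => (-1 : ℂ) ^ (α.map PNat.val).sum • M α) f) := by
        intro a f
        have : lift (fun α : List ℕ+ => (-1 : ℂ) ^ (α.map PNat.val).sum • M α) ∘ₗ
            prep addParts (some a) = (-1 : ℂ) ^ (a : ℕ) • (prep addParts (some a) ∘ₗ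
              lift (fun α : List ℕ+ => (-1 : ℂ) ^ (α.map PNat.val).sum • M α)) :=
          hom_ext fun w => by simp [M, pow_add, smul_smul]
        exact LinearMap.congr_fun this f
      simp only [← prep_some_word] at h1 h2 ⊢
      rw [cons_mul_cons]
      simp only [map_add, dOpt, addParts, Option.bind_some, key, h1, h2, h3]
      simp only [smul_mul_assoc, mul_smul_comm]
      rw [cons_mul_cons]
      simp only [dOpt, addParts, Option.bind_some, PNat.add_coe, pow_add, map_smul, smul_add,
        smul_smul]
      congr 2 <;> rw [mul_comm])

/-- The character `ζ̄` with `ζ̄ = (-1) ^ n ζ` on the homogeneous elements of degree `n`. -/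
def bar (χ : QSym →ₐ[ℂ] ℂ) : QSym →ₐ[ℂ] ℂ := χ.comp sign

open WithConv in
/-- The character `ν = bar (ζ⁻¹) ζ` of `QSym`; inverse and product are those of the group of
characters under convolution. -/
def nu : QSym →ₐ[ℂ] ℂ := (toConv (bar ((toConv zeta)⁻¹).ofConv) * toConv zeta).ofConv

end QSym

/-! ### The shuffle functions -/

/-- All ways of cutting a word into consecutive nonempty blocks. -/
def blockings {A : Type u} : List A → List (List (List A))
  | [] => [[]]
  | a :: w => (blockings w).flatMap fun B =>
      match B with
      | [] => [[[a]]]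
      | b :: B' => [[a] :: b :: B', (a :: b) :: B']

theorem mem_blockings {A : Type u} (w : List A) (B : List (List A)) :
    B ∈ blockings w ↔ B.flatten = w ∧ ∀ b ∈ B, b ≠ [] := by
  induction w generalizing B with
  | nil =>
    cases B with
    | nil => simp [blockings]
    | cons b B => simp [blockings]; tauto
  | cons a w ih =>
    simp only [blockings, List.mem_flatMap, ih]
    constructor
    · rintro ⟨C, ⟨rfl, hC⟩, hB⟩
      cases C with
      | nil => simp at hB; subst hB; simp
      | cons c C =>
        simp only [List.mem_cons, List.not_mem_nil, or_false] at hB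
        rcases hB with rfl | rfl <;> simp_all
    · rintro ⟨h, hB⟩
      match B, h, hB with
      | [] :: B, h, hB => simp at hB
      | [x] :: B, h, hB =>
        simp only [List.flatten_cons, List.cons_append, List.nil_append, List.cons.injEq] at h
        obtain ⟨rfl, rfl⟩ := h
        refine ⟨B, ⟨rfl, fun b hb => hB b (List.mem_cons_of_mem _ hb)⟩, ?_⟩
        cases B <;> simp
      | (x :: y :: b) :: B, h, hB =>
        simp only [List.flatten_cons, List.cons_append, List.cons.injEq] at h
        obtain ⟨rfl, rfl⟩ := h
        refine ⟨(y :: b) :: B, ⟨rfl, ?_⟩, by simp⟩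
        intro c hc
        rcases List.mem_cons.mp hc with rfl | hc
        · simp
        · exact hB c (List.mem_cons_of_mem _ hc)

theorem nodup_blockings {A : Type u} (w : List A) : (blockings w).Nodup := by
  induction w with
  | nil => simp [blockings]
  | cons a w ih =>
    rw [blockings, List.nodup_flatMap]
    refine ⟨fun B _ => by cases B <;> simp, ih.imp_of_mem fun {B C} hB hC hne => ?_⟩
    intro D hD hD'
    have hB' := ((mem_blockings w B).mp hB).2
    have hC' := ((mem_blockings w C).mp hC).2
    rcases B with _ | ⟨b, B⟩ <;> rcases C with _ | ⟨c, C⟩ <;> simp_all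
    rcases hD with rfl | rfl <;> simp_all

namespace QSym

open QuasiShuffle

/-- The sum of the parts in a nonempty block. -/
def blockSum (b : List ℕ+) : ℕ+ := (b.map PNat.val).sum.toPNat'

/-- The coefficient `1 / (O! E!)` of a block with `O` odd and `E` even parts. -/
def blockCoeff (b : List ℕ+) : ℂ :=
  1 / ((b.countP (fun a => decide (Odd (a : ℕ)))).factorial *
    (b.countP (fun a => decide (Even (a : ℕ)))).factorial : ℂ)

/-- No odd part of the block is immediately followed by an even part. -/
def NoOddEven (b : List ℕ+) : Prop := b.IsChain fun x y => ¬ (Odd (x : ℕ) ∧ Even (y : ℕ))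

instance (b : List ℕ+) : Decidable (NoOddEven b) :=
  inferInstanceAs (Decidable (b.IsChain fun x y => ¬ (Odd (x : ℕ) ∧ Even (y : ℕ))))

/-- The shuffle function `S_α = ∑ c_α^β M_β` over `m_o(α) ≤ β ≤ α`. A composition `β ≤ α` is a
cutting `B` of `α` into blocks, `β` being the composition of the block sums. The odd-min
composition `m_o(α)` is obtained by cutting `α` exactly between each odd part and an even part
that follows it immediately, so `m_o(α) ≤ β` says that `B` also cuts at all these places, that is,
no block of `B` has an odd part immediately followed by an even part. -/
def S (α : List ℕ+) : QSym :=
  (((blockings α).filter fun B => ∀ b ∈ B, NoOddEven b).map fun B =>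
    (B.map blockCoeff).prod • M (B.map blockSum)).sum

end QSym

/-! ### Graded Hopf algebras, combinatorial Hopf algebras and theta maps -/

section Combinatorial

variable {H K : Type*} [Ring H] [HopfAlgebra ℂ H] [Ring K] [HopfAlgebra ℂ K]

/-- `𝒜` makes the Hopf algebra `H` a graded connected Hopf algebra. -/
structure IsGradedConnected (𝒜 : ℕ → Submodule ℂ H) : Prop where
  isInternal : DirectSum.IsInternal 𝒜
  one_mem : (1 : H) ∈ 𝒜 0
  mul_mem : ∀ {m n : ℕ} {x y : H}, x ∈ 𝒜 m → y ∈ 𝒜 n → x * y ∈ 𝒜 (m + n)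
  counit_eq_zero : ∀ {n : ℕ} {x : H}, n ≠ 0 → x ∈ 𝒜 n → Coalgebra.counit (R := ℂ) x = 0
  comul_mem : ∀ {n : ℕ} {x : H}, x ∈ 𝒜 n → Coalgebra.comul (R := ℂ) x ∈
    ⨆ p ∈ Finset.HasAntidiagonal.antidiagonal n,
      LinearMap.range (TensorProduct.map (𝒜 p.1).subtype (𝒜 p.2).subtype)
  antipode_mem : ∀ {n : ℕ} {x : H}, x ∈ 𝒜 n → HopfAlgebra.antipode ℂ x ∈ 𝒜 n
  connected : 𝒜 0 = Submodule.span ℂ {1}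

/-- `(H, ζ)` is a combinatorial Hopf algebra: a graded connected Hopf algebra with a linear and
multiplicative functional `ζ`. -/
structure IsCombinatorialHopfAlgebra (𝒜 : ℕ → Submodule ℂ H) (ζ : H →ₗ[ℂ] ℂ) : Prop
    extends IsGradedConnected 𝒜 where
  char_one : ζ 1 = 1
  char_mul : ∀ x y : H, ζ (x * y) = ζ x * ζ y

/-- Morphisms of graded Hopf algebras. -/
structure IsGradedHopfMorphism (𝒜 : ℕ → Submodule ℂ H) (ℬ : ℕ → Submodule ℂ K)
    (f : H →ₗ[ℂ] K) : Prop where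
  map_one : f 1 = 1
  map_mul : ∀ x y : H, f (x * y) = f x * f y
  map_counit : ∀ x : H, Coalgebra.counit (R := ℂ) (f x) = Coalgebra.counit (R := ℂ) x
  map_comul : ∀ x : H, Coalgebra.comul (R := ℂ) (f x) =
    TensorProduct.map f f (Coalgebra.comul (R := ℂ) x)
  map_antipode : ∀ x : H, f (HopfAlgebra.antipode ℂ x) = HopfAlgebra.antipode ℂ (f x)
  map_mem : ∀ (n : ℕ) (x : H), x ∈ 𝒜 n → f x ∈ ℬ n

/-- Morphisms of combinatorial Hopf algebras. -/
structure IsCombinatorialHopfMorphism (𝒜 : ℕ → Submodule ℂ H) (ζ : H →ₗ[ℂ] ℂ)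
    (ℬ : ℕ → Submodule ℂ K) (ξ : K →ₗ[ℂ] ℂ) (f : H →ₗ[ℂ] K) : Prop
    extends IsGradedHopfMorphism 𝒜 ℬ f where
  char_comp : ξ ∘ₗ f = ζ

/-- `Φ` is the unique morphism of combinatorial Hopf algebras from `(H, ζ)` to `(QSym, ζ_QSym)`. -/
def IsCanonicalMorphism (𝒜 : ℕ → Submodule ℂ H) (ζ : H →ₗ[ℂ] ℂ) (Φ : H →ₗ[ℂ] QSym) : Prop :=
  IsCombinatorialHopfMorphism 𝒜 ζ QSym.grading QSym.zeta.toLinearMap Φ ∧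
    ∀ Φ' : H →ₗ[ℂ] QSym,
      IsCombinatorialHopfMorphism 𝒜 ζ QSym.grading QSym.zeta.toLinearMap Φ' → Φ' = Φ

/-- `Θ` is the map `Θ_QSym`: the unique morphism of combinatorial Hopf algebras from
`(QSym, bar (ζ_QSym⁻¹) ζ_QSym)` to `(QSym, ζ_QSym)`. -/
def IsThetaQSym (Θ : QSym →ₗ[ℂ] QSym) : Prop :=
  IsCombinatorialHopfAlgebra QSym.grading QSym.nu.toLinearMap ∧
    IsCanonicalMorphism QSym.grading QSym.nu.toLinearMap Θ

/-- `Θ` is a theta map for the combinatorial Hopf algebra `(H, ζ)`. -/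
def IsThetaMap (𝒜 : ℕ → Submodule ℂ H) (ζ : H →ₗ[ℂ] ℂ) (Θ : H →ₗ[ℂ] H) : Prop :=
  IsCombinatorialHopfAlgebra 𝒜 ζ ∧
    ∃ (Φ : H →ₗ[ℂ] QSym) (ΘQ : QSym →ₗ[ℂ] QSym),
      IsCanonicalMorphism 𝒜 ζ Φ ∧ IsThetaQSym ΘQ ∧ Φ ∘ₗ Θ = ΘQ ∘ₗ Φ

/-- `P` is a peak algebra for `(H, ζ)`: the image of a theta map. -/
def IsPeakAlgebra (𝒜 : ℕ → Submodule ℂ H) (ζ : H →ₗ[ℂ] ℂ) (P : Submodule ℂ H) : Prop :=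
  ∃ Θ : H →ₗ[ℂ] H, IsThetaMap 𝒜 ζ Θ ∧ LinearMap.range Θ = P

end Combinatorial

/-! ### Shuffle algebras -/

/-- No two letters are contracted. -/
def noContraction (ι : Type u) (_ _ : ι) : Option ι := none

instance (ι : Type u) : IsContraction (noContraction ι) where
  comm _ _ := rfl
  assoc _ _ _ := rfl

/-- The shuffle algebra `S(V)` of a complex vector space `V` with basis `(v_i)`, `i ∈ ι`: the basis
consists of the words in the letters `v_i`, the product is the shuffle product, the coproduct is
deconcatenation. -/
abbrev ShuffleAlgebra (ι : Type u) : Type u := QuasiShuffle (noContraction ι)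

namespace ShuffleAlgebra

open QuasiShuffle

variable {ι : Type u}

/-- The basis element `v_α = v_{α_1} ⋯ v_{α_ℓ}`. -/
def v (α : List ι) : ShuffleAlgebra ι := word (noContraction ι) α

/-- The grading of `S(V)` when the letter `v_i` has degree `deg i`. -/
def grading (deg : ι → ℕ+) : ℕ → Submodule ℂ (ShuffleAlgebra ι) :=
  QuasiShuffle.grading (noContraction ι) (fun i => (deg i : ℕ))

/-- The map `Φ_{S(V)}`, which sends `v_α` to `S_{(deg α_1, …, deg α_ℓ)}`. -/
def Phi (deg : ι → ℕ+) : ShuffleAlgebra ι →ₗ[ℂ] QSym := lift fun α => QSym.S (α.map deg)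

/-- The canonical character `ζ_{S(V)} = ζ_QSym ∘ Φ_{S(V)}`. -/
def zeta (deg : ι → ℕ+) : ShuffleAlgebra ι →ₗ[ℂ] ℂ := QSym.zeta.toLinearMap ∘ₗ Phi deg

/-- A word is odd if all its letters have odd degree. -/
def IsOdd (deg : ι → ℕ+) (α : List ι) : Prop := ∀ i ∈ α, Odd (deg i : ℕ)

open Classical in
/-- The map `Θ_{S(V)}`: it sends `v_α` to `2 ^ ℓ(α) v_α` if `α` is odd, and to `0` otherwise. -/
def Theta (deg : ι → ℕ+) : ShuffleAlgebra ι →ₗ[ℂ] ShuffleAlgebra ι :=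
  lift fun α => if IsOdd deg α then (2 : ℂ) ^ α.length • v α else 0

/-- The subspace `S(O(V))` of `S(V)` spanned by the odd words. -/
def oddPart (deg : ι → ℕ+) : Submodule ℂ (ShuffleAlgebra ι) :=
  Submodule.span ℂ (v '' {α | IsOdd deg α})

end ShuffleAlgebra

end

/-! `QSym` with `QSym.zeta` is a terminal object, and both sides of `Φ ∘ Θ = Θ_QSym ∘ Φ` are
compared through the characters they induce.

Terminality rests on primitives: a homogeneous primitive element of degree n in `QSym` is a multiple
of M_(n), and ζ_QSym(M_(n)) = 1, so ζ_QSym detects it (`QSym.eq_zero_of_primitive`). If two graded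
coalgebra maps to `QSym` agree on shorter words, their difference on a word is primitive. Hence such
maps are determined by their composite with ζ_QSym (`eq_of_zeta_comp_eq`), and by the same argument
they are multiplicative as soon as this composite is (`map_mul_of_zeta_comp`). Existence is
explicit: `toQSym` sums over the cuttings of a word into blocks, weighted by the values of the
character on the blocks.

On a shuffle algebra, let e be the character with value 1/ℓ! on words with all letters of even
degree, and o_c the one with value c^ℓ/ℓ! on odd words; both vanish on the other words. By the
binomial theorem o_c o_c' = o_(c+c') under convolution. A word contributes to e o_1 only if its even
letters precede its odd ones, and then its value is 1/(E! O!). So ζ_S(V) = e o_1 (`zeta_eq`), which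
makes it a character with `Phi` as its canonical morphism.

The bar involution multiplies by (-1)^n, and the parity of the degree is that of the number of odd
letters, so it turns e o_1 into e o_(-1). The character ν therefore pulls back along `Phi` to (e
o_(-1))⁻¹ (e o_1) = o_1 e⁻¹ e o_1 = o_2 (`convComp_phi_nu`). Since `Theta` multiplies odd letters by
2 and kills even ones, ζ_S(V) ∘ Θ is o_2 as well (`zeta_comp_Theta`), and terminality gives the
commutation. The inclusion in Π follows, as S(O(V)) is the range of `Theta`. -/

noncomputable section

/-! ### Bialgebra maps and antipodes -/

/-- A linear map between Hopf algebras that respects the bialgebra structures commutes with the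
antipodes. -/
theorem map_antipode_of_bialgebra {H K : Type*} [Ring H] [HopfAlgebra ℂ H] [Ring K]
    [HopfAlgebra ℂ K] (f : H →ₗ[ℂ] K) (map_one : f 1 = 1) (map_mul : ∀ x y, f (x * y) = f x * f y)
    (map_counit : ∀ x, Coalgebra.counit (R := ℂ) (f x) = Coalgebra.counit (R := ℂ) x)
    (map_comul : ∀ x, Coalgebra.comul (R := ℂ) (f x) =
      TensorProduct.map f f (Coalgebra.comul (R := ℂ) x)) (x : H) :
    f (HopfAlgebra.antipode ℂ x) = HopfAlgebra.antipode ℂ (f x) := by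
  let F : H →ₐ[ℂ] K := AlgHom.ofLinearMap f map_one map_mul
  let G : H →ₗc[ℂ] K :=
    { f with
      counit_comp := LinearMap.ext map_counit
      map_comp_comul := LinearMap.ext fun x => (map_comul x).symm }
  -- In the convolution algebra of linear maps H → K, composing `f` with the antipode of K gives a
  -- left inverse of `f`, and with that of H a right inverse; the two must coincide.
  have hl : WithConv.toConv (HopfAlgebra.antipode ℂ ∘ₗ f) * WithConv.toConv f = 1 := by
    have h := LinearMap.convMul_comp_coalgHom_distrib
      (WithConv.toConv (HopfAlgebra.antipode ℂ (A := K))) (WithConv.toConv LinearMap.id) G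
    rw [LinearMap.antipode_mul_id] at h
    apply WithConv.ofConv_injective
    refine h.symm.trans (LinearMap.ext fun x => ?_)
    change algebraMap ℂ K (Coalgebra.counit (f x)) = algebraMap ℂ K (Coalgebra.counit x)
    rw [map_counit]
  have hr : WithConv.toConv f * WithConv.toConv (f ∘ₗ HopfAlgebra.antipode ℂ) = 1 := by
    have h := LinearMap.algHom_comp_convMul_distrib F
      (WithConv.toConv LinearMap.id) (WithConv.toConv (HopfAlgebra.antipode ℂ (A := H)))
    rw [LinearMap.id_mul_antipode] at h
    apply WithConv.ofConv_injective
    refine h.symm.trans (LinearMap.ext fun x => ?_)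
    change F (algebraMap ℂ H (Coalgebra.counit x)) = algebraMap ℂ K (Coalgebra.counit x)
    exact F.commutes _
  exact (LinearMap.congr_fun (WithConv.toConv_injective (left_inv_eq_right_inv hl hr)) x).symm

namespace QuasiShuffle

variable {A : Type u} {d : A → A → Option A}

/-! ### The grading -/

/-- The weight of a contraction is the sum of the weights of the contracted letters. -/
def IsAdditiveWeight (d : A → A → Option A) (wt : A → ℕ) : Prop :=
  ∀ a b c, d a b = some c → wt c = wt a + wt b

theorem word_mem_grading (wt : A → ℕ) (w : List A) :
    word d w ∈ grading d wt (w.map wt).sum :=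
  Submodule.subset_span ⟨w, rfl, rfl⟩

theorem word_mem_grading_of_eq {wt : A → ℕ} {w : List A} {n : ℕ} (h : (w.map wt).sum = n) :
    word d w ∈ grading d wt n :=
  h ▸ word_mem_grading wt w

theorem grading_le {wt : A → ℕ} {n : ℕ} {p : Submodule ℂ (QuasiShuffle d)}
    (h : ∀ w : List A, (w.map wt).sum = n → word d w ∈ p) : grading d wt n ≤ p :=
  Submodule.span_le.mpr (by rintro _ ⟨w, hw, rfl⟩; exact h w hw)

/-- The weight partitions the word basis, and disjoint parts of a basis span independent subspaces.
-/
theorem isInternal_grading (wt : A → ℕ) : DirectSum.IsInternal (grading d wt) := by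
  refine DirectSum.isInternal_submodule_of_iSupIndep_of_iSup_eq_top (fun n => ?_) ?_
  · have h : ⨆ j, ⨆ (_ : j ≠ n), grading d wt j ≤
        Submodule.span ℂ (word d '' {w | (w.map wt).sum ≠ n}) :=
      iSup₂_le fun j hj => Submodule.span_mono (Set.image_mono fun w hw => by
        rw [Set.mem_ofPred_eq] at hw ⊢; omega)
    refine Disjoint.mono_right h ((wordBasis d).linearIndependent.disjoint_span_image ?_)
    exact Set.disjoint_left.mpr fun w h1 h2 => h2 h1
  · rw [eq_top_iff, ← (wordBasis d).span_eq, Submodule.span_le]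
    rintro _ ⟨w, rfl⟩
    exact Submodule.mem_iSup_of_mem _ (word_mem_grading wt w)

theorem sum_map_of_mem_quasiShuffle {wt : A → ℕ} (hwt : IsAdditiveWeight d wt) (u v w : List A)
    (hw : w ∈ quasiShuffle d u v) : (w.map wt).sum = (u.map wt).sum + (v.map wt).sum := by
  induction u, v using quasiShuffle.induct generalizing w with
  | case1 v => simp_all [quasiShuffle]
  | case2 a u => simp_all [quasiShuffle]
  | case3 a u b v h1 h2 h3 =>
    rw [quasiShuffle] at hw
    simp only [Multiset.mem_add, Multiset.mem_map] at hw
    rcases hw with (⟨x, hx, rfl⟩ | ⟨x, hx, rfl⟩) | hw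
    · have := h1 x hx
      simp only [List.map_cons, List.sum_cons] at this ⊢
      omega
    · have := h2 x hx
      simp only [List.map_cons, List.sum_cons] at this ⊢
      omega
    · cases hc : d a b with
      | none => simp [hc] at hw
      | some c =>
        simp only [hc, Option.elim_some, Multiset.mem_map] at hw
        obtain ⟨x, hx, rfl⟩ := hw
        have := h3 x hx
        have := hwt a b c hc
        simp only [List.map_cons, List.sum_cons] at this ⊢
        omega

theorem counitMap_word (w : List A) : counitMap d (word d w) = if w = [] then 1 else 0 := by
  simp [counitMap]

/-! ### Rescaling letters -/

/-- The map multiplying every letter `a` by the scalar `c a`. -/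
def scale (d : A → A → Option A) (c : A → ℂ) : QuasiShuffle d →ₗ[ℂ] QuasiShuffle d :=
  lift fun w => (w.map c).prod • word d w

theorem scale_word (c : A → ℂ) (w : List A) :
    scale d c (word d w) = (w.map c).prod • word d w :=
  lift_word _ _

theorem scale_one (c : A → ℂ) : scale d c 1 = 1 := by
  rw [one_def, scale_word]; simp

theorem scale_prep (c : A → ℂ) (a : A) (x : QuasiShuffle d) :
    scale d c (prep d (some a) x) = c a • prep d (some a) (scale d c x) := by
  have : scale d c ∘ₗ prep d (some a) = c a • (prep d (some a) ∘ₗ scale d c) :=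
    hom_ext fun w => by simp [scale_word, mul_smul]
  exact LinearMap.congr_fun this x

theorem counit_scale (c : A → ℂ) (x : QuasiShuffle d) :
    counitMap d (scale d c x) = counitMap d x := by
  have : counitMap d ∘ₗ scale d c = counitMap d := hom_ext fun w => by
    cases w <;> simp [scale_word, counitMap_word]
  exact LinearMap.congr_fun this x

theorem comul_scale (c : A → ℂ) (x : QuasiShuffle d) :
    comulMap d (scale d c x) = TensorProduct.map (scale d c) (scale d c) (comulMap d x) := by
  have : comulMap d ∘ₗ scale d c = TensorProduct.map (scale d c) (scale d c) ∘ₗ comulMap d :=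
    hom_ext fun w => by
      simp only [LinearMap.comp_apply, scale_word, map_smul, comul_word, map_sum,
        TensorProduct.map_tmul, Finset.smul_sum, TensorProduct.smul_tmul_smul]
      refine Finset.sum_congr rfl fun i _ => ?_
      rw [← List.prod_append, ← List.map_append, List.take_append_drop]
  exact LinearMap.congr_fun this x

theorem scale_mem_grading (c : A → ℂ) {wt : A → ℕ} {n : ℕ} {x : QuasiShuffle d}
    (hx : x ∈ grading d wt n) : scale d c x ∈ grading d wt n := by
  have h : grading d wt n ≤ (grading d wt n).comap (scale d c) := grading_le fun w hw => by
    rw [Submodule.mem_comap, scale_word]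
    exact Submodule.smul_mem _ _ (word_mem_grading_of_eq hw)
  exact h hx

/-! ### Gradings and rescalings are compatible with the Hopf structure -/

theorem mul_mem_grading {wt : A → ℕ} (hwt : IsAdditiveWeight d wt) {m n : ℕ}
    {x y : QuasiShuffle d} (hx : x ∈ grading d wt m) (hy : y ∈ grading d wt n) :
    x * y ∈ grading d wt (m + n) := by
  have h : grading d wt m ≤ (grading d wt (m + n)).comap ((mulMap d).flip y) := by
    refine grading_le fun u hu => ?_
    have h' : grading d wt n ≤ (grading d wt (m + n)).comap (mulMap d (word d u)) := by
      refine grading_le fun v hv => ?_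
      change word d u * word d v ∈ grading d wt (m + n)
      rw [word_mul_word]
      refine multiset_sum_mem _ fun z hz => ?_
      obtain ⟨w, hw, rfl⟩ := Multiset.mem_map.mp hz
      exact word_mem_grading_of_eq (by
        rw [sum_map_of_mem_quasiShuffle hwt u v w hw, hu, hv])
    exact h' hy
  exact h hx

theorem leftInvWord_mem_grading {wt : A → ℕ} (hwt : IsAdditiveWeight d wt) (w : List A) :
    leftInvWord d w ∈ grading d wt (w.map wt).sum := by
  induction h : w.length using Nat.strong_induction_on generalizing w with
  | _ n ih =>
    cases w with
    | nil => rw [leftInvWord]; exact word_mem_grading wt []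
    | cons a u =>
      rw [leftInvWord]
      refine Submodule.neg_mem _ (Submodule.sum_mem _ fun i _ => ?_)
      -- The index satisfies i ≤ |u|, so the prefix of `a :: u` is proper and the induction applies.
      have hi : ((a :: u).take i).length < n := by
        rw [List.length_take, ← h, List.length_cons]; omega
      have hsum : ((a :: u).map wt).sum =
          (((a :: u).take i).map wt).sum + (((a :: u).drop i).map wt).sum := by
        rw [← List.sum_append, ← List.map_append, List.take_append_drop]
      rw [hsum]
      exact mul_mem_grading hwt (ih _ hi _ rfl) (word_mem_grading wt _)

variable [IsContraction d]

theorem antipode_word (w : List A) :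
    HopfAlgebra.antipode ℂ (word d w) = leftInvWord d w :=
  lift_word _ _

/-- Positivity of the weights serves connectedness: it leaves the empty word as the only one of
weight zero. -/
theorem isGradedConnected_grading {wt : A → ℕ} (hwt : IsAdditiveWeight d wt)
    (hpos : ∀ a, 0 < wt a) : IsGradedConnected (grading d wt) where
  isInternal := isInternal_grading wt
  one_mem := word_mem_grading wt []
  mul_mem := mul_mem_grading hwt
  counit_eq_zero {n x} hn hx := by
    have h : grading d wt n ≤ LinearMap.ker (counitMap d) := grading_le fun w hw => by
      rw [LinearMap.mem_ker, counitMap_word, if_neg]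
      rintro rfl
      exact hn hw.symm
    exact h hx
  comul_mem {n x} hx := by
    have h : grading d wt n ≤ (⨆ p ∈ Finset.HasAntidiagonal.antidiagonal n,
        LinearMap.range (TensorProduct.map (grading d wt p.1).subtype
          (grading d wt p.2).subtype)).comap (comulMap d) := by
      refine grading_le fun w hw => ?_
      rw [Submodule.mem_comap, comul_word]
      refine Submodule.sum_mem _ fun i _ => ?_
      refine Submodule.mem_iSup_of_mem
        (((w.take i).map wt).sum, ((w.drop i).map wt).sum) (Submodule.mem_iSup_of_mem ?_ ?_)
      · rw [Finset.HasAntidiagonal.mem_antidiagonal, ← List.sum_append, ← List.map_append,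
          List.take_append_drop, hw]
      · exact ⟨(⟨_, word_mem_grading wt _⟩ : grading d wt _) ⊗ₜ
          (⟨_, word_mem_grading wt _⟩ : grading d wt _), by simp⟩
    exact h hx
  antipode_mem {n x} hx := by
    have h : grading d wt n ≤ (grading d wt n).comap (HopfAlgebra.antipode ℂ) :=
      grading_le fun w hw => by
        rw [Submodule.mem_comap, antipode_word, ← hw]
        exact leftInvWord_mem_grading hwt w
    exact h hx
  connected := by
    rw [grading, one_def, ← Set.image_singleton]
    congr 2
    ext w
    constructor
    · intro hw
      cases w with
      | nil => rfl
      | cons a u =>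
        have := hpos a
        simp only [Set.mem_ofPred_eq, List.map_cons, List.sum_cons] at hw
        omega
    · rintro rfl
      rfl

/-- The shuffle terms rescale correctly for any `c`; only the contraction terms need `c` to be
multiplicative. -/
theorem scale_mul {c : A → ℂ} (hc : ∀ a b e, d a b = some e → c e = c a * c b)
    (x y : QuasiShuffle d) : scale d c (x * y) = scale d c x * scale d c y := by
  refine map_mul_of_word _ (scale_one c) (fun a u b v h1 h2 h3 => ?_) x y
  simp only [← prep_some_word] at h1 h2 ⊢
  have h4 : scale d c (prep d (d a b) (word d u * word d v)) =
      (c a * c b) • prep d (d a b) (scale d c (word d u) * scale d c (word d v)) := by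
    cases he : d a b with
    | none => simp
    | some e => rw [scale_prep, h3, hc a b e he]
  rw [cons_mul_cons]
  simp only [map_add, scale_prep, h1, h2, dOpt, Option.bind_some, h4]
  simp only [smul_mul_assoc, mul_smul_comm]
  rw [cons_mul_cons]
  simp only [dOpt, Option.bind_some, map_smul, smul_add, smul_smul]
  rw [mul_comm (c b) (c a)]

/-- Covers both the sign automorphism of `QSym`, where c(a) = (-1)^a turns sums of parts into
products, and `Theta`, where no letters contract. -/
theorem isGradedHopfMorphism_scale {c : A → ℂ} (hc : ∀ a b e, d a b = some e → c e = c a * c b)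
    (wt : A → ℕ) : IsGradedHopfMorphism (grading d wt) (grading d wt) (scale d c) where
  map_one := scale_one c
  map_mul := scale_mul hc
  map_counit := counit_scale c
  map_comul := comul_scale c
  map_antipode := map_antipode_of_bialgebra _ (scale_one c) (scale_mul hc) (counit_scale c)
    (comul_scale c)
  map_mem _ _ hx := scale_mem_grading c hx

end QuasiShuffle

/-! ### Homogeneous primitive elements of `QSym` and uniqueness -/

namespace QuasiShuffle

variable {A : Type u} {d : A → A → Option A}

theorem coord_word (v w : List A) [Decidable (w = v)] :
    (wordBasis d).coord v (word d w) = if w = v then 1 else 0 := by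
  classical
  rw [Module.Basis.coord_apply, word, Module.Basis.repr_self, Finsupp.single_apply]

/-- Only the cut after the first letter can produce `[a]` on the left. Coefficients of longer words
are thus read off the coproduct, which is known for a primitive element. -/
theorem coord_cons (a : A) (v : List A) (x : QuasiShuffle d) :
    (wordBasis d).coord (a :: v) x = LinearMap.mul' ℂ ℂ (TensorProduct.map
      ((wordBasis d).coord [a]) ((wordBasis d).coord v) (comulMap d x)) := by
  classical
  have : (wordBasis d).coord (a :: v) = LinearMap.mul' ℂ ℂ ∘ₗ TensorProduct.map
      ((wordBasis d).coord [a]) ((wordBasis d).coord v) ∘ₗ comulMap d := hom_ext fun w => by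
    simp only [LinearMap.comp_apply, comul_word, map_sum, TensorProduct.map_tmul,
      LinearMap.mul'_apply, coord_word]
    cases w with
    | nil => simp
    | cons b u =>
      rw [Finset.sum_eq_single 1]
      · by_cases h : b = a <;> simp [h]
      · intro i _ hi
        rw [if_neg, zero_mul]
        intro h
        rcases i with _ | _ | i
        · simp at h
        · exact hi rfl
        -- If `u` is empty, the range of the index has to exclude this case, because `take` would
        -- still return `[b]`.
        · cases u <;> simp_all
      · simp
  exact LinearMap.congr_fun this x

theorem coord_of_mem_grading {wt : A → ℕ} {n : ℕ} {x : QuasiShuffle d}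
    (hx : x ∈ grading d wt n) {v : List A} (hv : (v.map wt).sum ≠ n) :
    (wordBasis d).coord v x = 0 := by
  classical
  have h : grading d wt n ≤ LinearMap.ker ((wordBasis d).coord v) := grading_le fun w hw => by
    rw [LinearMap.mem_ker, coord_word, if_neg]
    rintro rfl
    exact hv hw
  exact h hx

theorem coord_nil (x : QuasiShuffle d) : (wordBasis d).coord [] x = counitMap d x := by
  classical
  have : (wordBasis d).coord [] = counitMap d := hom_ext fun w => by
    rw [coord_word, counitMap_word]
  exact LinearMap.congr_fun this x

variable [IsContraction d]

/-- Primitive elements are combinations of words of length one. -/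
theorem coord_of_primitive {x : QuasiShuffle d}
    (hx : comulMap d x = 1 ⊗ₜ x + x ⊗ₜ 1) {v : List A} (hv : v.length ≠ 1) :
    (wordBasis d).coord v x = 0 := by
  classical
  match v, hv with
  | [], _ =>
    -- The counit law applied to Δx = 1 ⊗ x + x ⊗ 1 leaves ε(x) ⊗ 1 = 0; applying ε to the second
    -- factor gives ε(x) = 0.
    have h := Coalgebra.rTensor_counit_comul (R := ℂ) x
    rw [comul_def, hx, map_add, LinearMap.rTensor_tmul, LinearMap.rTensor_tmul, counit_def,
      counit_def, counit_one', add_eq_left] at h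
    have h' := congrArg (LinearMap.mul' ℂ ℂ ∘ₗ (counitMap d).lTensor ℂ) h
    rw [coord_nil]
    simpa [counit_one'] using h'
  | a :: b :: v, _ =>
    rw [coord_cons, hx, one_def, map_add, map_add, TensorProduct.map_tmul, TensorProduct.map_tmul,
      LinearMap.mul'_apply, LinearMap.mul'_apply, coord_word, coord_word]
    simp

end QuasiShuffle

namespace QSym

open QuasiShuffle

/-- Primitivity leaves only compositions with one part, and homogeneity leaves only the part n. So x
is a multiple of M_(n), on which ζ takes the value 1; in degree 0 there is no such composition at
all. -/
theorem eq_zero_of_primitive {n : ℕ} {x : QSym} (hn : x ∈ grading n)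
    (hx : comulMap addParts x = 1 ⊗ₜ x + x ⊗ₜ 1) (hζ : zeta x = 0) : x = 0 := by
  classical
  have key : ∀ v : List ℕ+, (∀ a : ℕ+, v = [a] → (a : ℕ) ≠ n) →
      (wordBasis addParts).coord v x = 0 := by
    intro v hv
    by_cases h1 : v.length = 1
    · obtain ⟨a, rfl⟩ := List.length_eq_one_iff.mp h1
      exact coord_of_mem_grading hn (by simpa using hv a rfl)
    · exact coord_of_primitive hx h1
  rcases Nat.eq_zero_or_pos n with rfl | hpos
  · exact (wordBasis addParts).ext_elem fun v => by
      simpa using key v fun a _ => a.ne_zero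
  · let a : ℕ+ := ⟨n, hpos⟩
    have h : x = (wordBasis addParts).coord [a] x • M [a] := by
      refine (wordBasis addParts).ext_elem fun v => ?_
      change (wordBasis addParts).coord v x = (wordBasis addParts).coord v
        ((wordBasis addParts).coord [a] x • word addParts [a])
      rw [map_smul, coord_word]
      split_ifs with hv
      · simp [← hv]
      · rw [key v fun b hb hbn => hv ?_, smul_zero]
        rw [hb, show b = a from PNat.eq hbn]
    rw [h, map_smul, zeta_M] at hζ
    rw [h, show (wordBasis addParts).coord [a] x = 0 by simpa using hζ, zero_smul]

end QSym

namespace QuasiShuffle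

variable {A : Type u} {d : A → A → Option A}

/-- Graded coalgebra maps to `QSym` are determined by their composition with `ζ_QSym`. -/
theorem eq_of_zeta_comp_eq {wt : A → ℕ} {f g : QuasiShuffle d →ₗ[ℂ] QSym}
    (hf1 : f (word d []) = 1) (hg1 : g (word d []) = 1)
    (hfΔ : ∀ x, comulMap addParts (f x) = TensorProduct.map f f (comulMap d x))
    (hgΔ : ∀ x, comulMap addParts (g x) = TensorProduct.map g g (comulMap d x))
    (hf : ∀ n, ∀ x ∈ grading d wt n, f x ∈ QSym.grading n)
    (hg : ∀ n, ∀ x ∈ grading d wt n, g x ∈ QSym.grading n)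
    (hζ : ∀ x, QSym.zeta (f x) = QSym.zeta (g x)) : f = g := by
  refine hom_ext fun w => ?_
  induction h : w.length using Nat.strong_induction_on generalizing w with
  | _ n ih =>
    rcases eq_or_ne w [] with rfl | hw
    · rw [hf1, hg1]
    have hlen : 0 < w.length := List.length_pos_iff.mpr hw
    have hmem : word d w ∈ grading d wt _ := word_mem_grading wt w
    -- By induction the proper cuts of `w` contribute equally to the coproducts of `f w` and `g w`.
    -- The two trivial cuts remain and show that the difference is primitive.
    refine sub_eq_zero.mp (QSym.eq_zero_of_primitive
      (Submodule.sub_mem _ (hf _ _ hmem) (hg _ _ hmem)) ?_ (by rw [map_sub, hζ, sub_self]))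
    rw [map_sub, hfΔ, hgΔ, comul_word, map_sum, map_sum, ← Finset.sum_sub_distrib,
      Finset.sum_eq_add_of_mem 0 w.length (by simp) (by simp) hlen.ne]
    · simp [hf1, hg1, TensorProduct.tmul_sub, TensorProduct.sub_tmul]
    · intro i hi hne
      have hi' : i < w.length + 1 := Finset.mem_range.mp hi
      rw [TensorProduct.map_tmul, TensorProduct.map_tmul,
        ih (w.take i).length (by rw [List.length_take]; omega) _ rfl,
        ih (w.drop i).length (by rw [List.length_drop]; omega) _ rfl, sub_self]

variable [IsContraction d]

/-- A graded coalgebra map to `QSym` is multiplicative if its composition with `ζ_QSym` is. -/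
theorem map_mul_of_zeta_comp {wt : A → ℕ} (hwt : IsAdditiveWeight d wt)
    {f : QuasiShuffle d →ₗ[ℂ] QSym} (hf1 : f 1 = 1)
    (hfΔ : ∀ x, comulMap addParts (f x) = TensorProduct.map f f (comulMap d x))
    (hf : ∀ n, ∀ x ∈ grading d wt n, f x ∈ QSym.grading n)
    (hζ : ∀ x y, QSym.zeta (f (x * y)) = QSym.zeta (f x) * QSym.zeta (f y))
    (x y : QuasiShuffle d) : f (x * y) = f x * f y := by
  have key : ∀ u v : List A, f (word d u * word d v) = f (word d u) * f (word d v) := by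
    intro u v
    induction h : u.length + v.length using Nat.strong_induction_on generalizing u v with
    | _ n ih =>
      rcases Nat.eq_zero_or_pos (u.length + v.length) with h0 | hpos
      · rw [List.length_eq_zero_iff.mp (by omega : u.length = 0), ← one_def, hf1, one_mul, one_mul]
      have hu : word d u ∈ grading d wt _ := word_mem_grading wt u
      have hv : word d v ∈ grading d wt _ := word_mem_grading wt v
      -- The difference f(uv) - f(u)f(v) is primitive: its coproduct is a sum over pairs of cuts,
      -- and induction on the total length cancels all pairs except (0, 0) and (|u|, |v|).
      refine sub_eq_zero.mp (QSym.eq_zero_of_primitive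
        (Submodule.sub_mem _ (hf _ _ (mul_mem_grading hwt hu hv))
          (mul_mem_grading (fun a b c hc => ?_) (hf _ _ hu) (hf _ _ hv))) ?_
        (by rw [map_sub, hζ, map_mul, sub_self]))
      · cases hc; rfl
      have e1 : comulMap d (word d u) * comulMap d (word d v) =
          ∑ p ∈ Finset.range (u.length + 1) ×ˢ Finset.range (v.length + 1),
            (word d (u.take p.1) * word d (v.take p.2)) ⊗ₜ[ℂ]
              (word d (u.drop p.1) * word d (v.drop p.2)) := by
        rw [comul_word, comul_word, Finset.sum_mul_sum, Finset.sum_product]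
        simp
      have e2 : comulMap addParts (f (word d u)) * comulMap addParts (f (word d v)) =
          ∑ p ∈ Finset.range (u.length + 1) ×ˢ Finset.range (v.length + 1),
            (f (word d (u.take p.1)) * f (word d (v.take p.2))) ⊗ₜ[ℂ]
              (f (word d (u.drop p.1)) * f (word d (v.drop p.2))) := by
        rw [hfΔ, hfΔ, comul_word, comul_word, map_sum, map_sum, Finset.sum_mul_sum,
          Finset.sum_product]
        simp
      rw [map_sub, hfΔ, comul_mul', comul_mul', e1, e2, map_sum, ← Finset.sum_sub_distrib,
        Finset.sum_eq_add_of_mem (0, 0) (u.length, v.length) (by simp) (by simp)]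
      · simp [← one_def, hf1, TensorProduct.tmul_sub, TensorProduct.sub_tmul]
      · simp only [ne_eq, Prod.mk.injEq]; omega
      · rintro ⟨i, j⟩ hij ⟨h1, h2⟩
        simp only [Finset.mem_product, Finset.mem_range] at hij
        simp only [ne_eq, Prod.mk.injEq] at h1 h2
        rw [TensorProduct.map_tmul,
          ih ((u.take i).length + (v.take j).length)
            (by rw [List.length_take, List.length_take]; omega) _ _ rfl,
          ih ((u.drop i).length + (v.drop j).length)
            (by rw [List.length_drop, List.length_drop]; omega) _ _ rfl, sub_self]
  have h : (mulMap d).compr₂ f = ((mulMap addParts).compl₁₂ f f) :=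
    hom_ext fun u => hom_ext fun v => key u v
  exact LinearMap.congr_fun (LinearMap.congr_fun h x) y

end QuasiShuffle

/-! ### The canonical morphism attached to a character -/

/-- Sorts the cuttings by their first block `a :: w.take i`; the other blocks cut `w.drop i`. -/
theorem sum_blockings_cons {A : Type u} {N : Type*} [AddCommMonoid N] (a : A) (w : List A)
    (f : List (List A) → N) :
    ((blockings (a :: w)).map f).sum =
      ∑ i ∈ Finset.range (w.length + 1),
        ((blockings (w.drop i)).map fun B => f ((a :: w.take i) :: B)).sum := by
  induction w generalizing a f with
  | nil => simp [blockings]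
  | cons b w ih =>
    -- `g` is `f` after merging `a` into the first block. Its value at `[]` is irrelevant, since a
    -- cutting of the nonempty word `b :: w` has a block.
    obtain ⟨g, hg⟩ : ∃ g : List (List A) → N, ∀ c B, g (c :: B) = f ((a :: c) :: B) :=
      ⟨fun B => match B with
        | [] => 0
        | c :: B' => f ((a :: c) :: B'), fun _ _ => rfl⟩
    have h1 : ((blockings (a :: b :: w)).map f).sum =
        ((blockings (b :: w)).map fun B => f ([a] :: B) + g B).sum := by
      rw [blockings, List.map_flatMap, List.flatMap_def, List.sum_flatten, List.map_map]
      congr 1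
      refine List.map_congr_left fun B hB => ?_
      cases B with
      | nil => simpa using ((mem_blockings _ _).mp hB).1
      | cons c B => simp [hg]
    rw [h1, List.sum_map_add, ih b g, List.length_cons, Finset.sum_range_succ' _ (w.length + 1),
      add_comm]
    simp [hg]

theorem blockings_map {A B : Type*} (g : A → B) (w : List A) :
    blockings (w.map g) = (blockings w).map (List.map (List.map g)) := by
  induction w with
  | nil => simp [blockings]
  | cons a w ih =>
    rw [List.map_cons, blockings, blockings, ih, List.flatMap_map, List.map_flatMap]
    congr 1
    funext C
    cases C <;> simp

namespace QuasiShuffle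

variable {A : Type u} {d : A → A → Option A}

/-- The map `w ↦ ∑ χ(w₁) ⋯ χ(wₖ) M_(|w₁|, …, |wₖ|)` over all ways of cutting the word `w` into
consecutive nonempty blocks. -/
def toQSym (d : A → A → Option A) (wt : A → ℕ+) (χ : List A → ℂ) : QuasiShuffle d →ₗ[ℂ] QSym :=
  lift fun w => ((blockings w).map fun B =>
    (B.map χ).prod • QSym.M (B.map fun b => QSym.blockSum (b.map wt))).sum

variable (wt : A → ℕ+) (χ : List A → ℂ)

theorem toQSym_nil : toQSym d wt χ (word d []) = 1 := by
  simp [toQSym, blockings, one_def, QSym.M]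

theorem toQSym_cons (a : A) (u : List A) :
    toQSym d wt χ (word d (a :: u)) = ∑ i ∈ Finset.range (u.length + 1), χ (a :: u.take i) •
      prep addParts (some (QSym.blockSum ((a :: u.take i).map wt)))
        (toQSym d wt χ (word d (u.drop i))) := by
  rw [toQSym, lift_word, sum_blockings_cons]
  refine Finset.sum_congr rfl fun i _ => ?_
  rw [lift_word, map_list_sum, List.smul_sum, List.map_map, List.map_map]
  congr 1
  refine List.map_congr_left fun B _ => ?_
  simp [QSym.M, mul_smul]

theorem counit_toQSym (x : QuasiShuffle d) :
    counitMap addParts (toQSym d wt χ x) = counitMap d x := by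
  have : counitMap addParts ∘ₗ toQSym d wt χ = counitMap d := hom_ext fun w => by
    rw [LinearMap.comp_apply, counitMap_word]
    cases w with
    | nil => rw [toQSym_nil, counit_one', if_pos rfl]
    | cons a u => simp [toQSym_cons, counit_prep]
  exact LinearMap.congr_fun this x

/-- To cut a composition of block sums is to cut the word at a block boundary, so it amounts to
cutting the word first and then dividing both halves into blocks. -/
theorem comul_toQSym (x : QuasiShuffle d) :
    comulMap addParts (toQSym d wt χ x) =
      TensorProduct.map (toQSym d wt χ) (toQSym d wt χ) (comulMap d x) := by
  have key : ∀ w : List A, comulMap addParts (toQSym d wt χ (word d w)) =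
      ∑ i ∈ Finset.range (w.length + 1),
        toQSym d wt χ (word d (w.take i)) ⊗ₜ[ℂ] toQSym d wt χ (word d (w.drop i)) := by
    intro w
    induction h : w.length using Nat.strong_induction_on generalizing w with
    | _ n ih =>
      subst h
      cases w with
      | nil => simp [toQSym_nil, comul_one', Algebra.TensorProduct.one_def]
      | cons a u =>
        -- The cut before the first letter is split off; it matches the terms `1 ⊗ₜ _` of
        -- `comul_prep`.
        rw [List.length_cons, Finset.sum_range_succ']
        simp only [List.take_succ_cons, List.drop_succ_cons, List.take_zero, List.drop_zero,
          toQSym_nil]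
        rw [toQSym_cons, map_sum, TensorProduct.tmul_sum]
        simp only [map_smul, comul_prep, smul_add, Finset.sum_add_distrib]
        rw [add_comm]
        congr 1
        · have e : ∀ i ∈ Finset.range (u.length + 1), χ (a :: u.take i) • (prep addParts
              (some (QSym.blockSum ((a :: u.take i).map wt)))).rTensor QSym
                (comulMap addParts (toQSym d wt χ (word d (u.drop i)))) =
              ∑ k ∈ Finset.range (u.length + 1 - i),
                (χ (a :: u.take i) • prep addParts
                  (some (QSym.blockSum ((a :: u.take i).map wt)))
                    (toQSym d wt χ (word d ((u.drop i).take k)))) ⊗ₜ[ℂ]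
                  toQSym d wt χ (word d (u.drop (i + k))) := by
            intro i hi
            have hi' : i < u.length + 1 := Finset.mem_range.mp hi
            rw [ih (u.drop i).length (by rw [List.length_drop, List.length_cons]; omega) _ rfl,
              List.length_drop, map_sum, Finset.smul_sum,
              show u.length - i + 1 = u.length + 1 - i by omega]
            refine Finset.sum_congr rfl fun k _ => ?_
            rw [LinearMap.rTensor_tmul, List.drop_drop, TensorProduct.smul_tmul']
          -- The pair (i, k), with first block `a :: u.take i` and k more letters before the cut, is
          -- regrouped by m = i + k, a cut after m + 1 letters of `a :: u`.
          rw [Finset.sum_congr rfl e, ← Finset.sum_range_diag_flip]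
          refine Finset.sum_congr rfl fun m hm => ?_
          have hm' : m < u.length + 1 := Finset.mem_range.mp hm
          rw [toQSym_cons, TensorProduct.sum_tmul, List.length_take,
            show min m u.length + 1 = m + 1 by omega]
          refine Finset.sum_congr rfl fun i hi => ?_
          have hi' : i < m + 1 := Finset.mem_range.mp hi
          rw [List.take_take, List.drop_take, show i + (m - i) = m by omega,
            show min i m = i by omega]
        · simp
  have : comulMap addParts ∘ₗ toQSym d wt χ =
      TensorProduct.map (toQSym d wt χ) (toQSym d wt χ) ∘ₗ comulMap d := hom_ext fun w => by
    simp [key, comul_word]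
  exact LinearMap.congr_fun this x

theorem zeta_prep (a : ℕ+) (x : QSym) :
    QSym.zeta (prep addParts (some a) x) = counitMap addParts x := by
  refine (QSym.lift_evalOneWord_prep (1 : ℂ) a x).trans ?_
  simp

/-- ζ_QSym kills compositions with two or more parts, so only the cutting of a nonempty word into a
single block survives. -/
theorem zeta_toQSym (h : χ [] = 1) (w : List A) :
    QSym.zeta (toQSym d wt χ (word d w)) = χ w := by
  cases w with
  | nil => rw [toQSym_nil, map_one, h]
  | cons a u =>
    rw [toQSym_cons, map_sum]
    simp only [map_smul, zeta_prep, counit_toQSym, counitMap_word]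
    rw [Finset.sum_eq_single u.length]
    · simp
    · intro i hi hne
      have hi' : i < u.length + 1 := Finset.mem_range.mp hi
      rw [if_neg, smul_zero]
      rw [List.drop_eq_nil_iff]
      omega
    · simp

/-- `toPNat'` replaces 0 by 1, which does not matter for a nonempty block. -/
theorem coe_blockSum_cons (a : ℕ+) (b : List ℕ+) :
    (QSym.blockSum (a :: b) : ℕ) = a + (b.map PNat.val).sum := by
  rw [QSym.blockSum, List.map_cons, List.sum_cons]
  rw [Nat.toPNat'_coe, if_pos (Nat.add_pos_left a.pos _)]

theorem toQSym_mem_grading {n : ℕ} {x : QuasiShuffle d}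
    (hx : x ∈ grading d (fun a => (wt a : ℕ)) n) : toQSym d wt χ x ∈ QSym.grading n := by
  have h : grading d (fun a => (wt a : ℕ)) n ≤ (QSym.grading n).comap (toQSym d wt χ) := by
    refine grading_le fun w hw => ?_
    rw [Submodule.mem_comap, toQSym, lift_word]
    refine list_sum_mem fun y hy => ?_
    obtain ⟨B, hB, rfl⟩ := List.mem_map.mp hy
    refine Submodule.smul_mem _ _ (word_mem_grading_of_eq ?_)
    obtain ⟨rfl, hne⟩ := (mem_blockings w B).mp hB
    rw [← hw, List.map_flatten, List.sum_flatten, List.map_map, List.map_map]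
    congr 1
    refine List.map_congr_left fun b hb => ?_
    obtain ⟨a, b, rfl⟩ := List.exists_cons_of_ne_nil (hne b hb)
    simp [coe_blockSum_cons, Function.comp_def]
  exact h hx

variable [IsContraction d] {wt}

/-- The canonical morphism to `QSym` attached to a character of a quasi-shuffle algebra. -/
theorem isCanonicalMorphism_toQSym (hwt : IsAdditiveWeight d fun a => (wt a : ℕ))
    {ζ : QuasiShuffle d →ₗ[ℂ] ℂ} (h1 : ζ 1 = 1) (hmul : ∀ x y, ζ (x * y) = ζ x * ζ y) :
    IsCanonicalMorphism (grading d fun a => (wt a : ℕ)) ζ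
      (toQSym d wt fun w => ζ (word d w)) := by
  have hζ : QSym.zeta.toLinearMap ∘ₗ toQSym d wt (fun w => ζ (word d w)) = ζ :=
    hom_ext fun w => zeta_toQSym wt _ h1 w
  have hζ' := LinearMap.congr_fun hζ
  simp only [LinearMap.comp_apply, AlgHom.toLinearMap_apply] at hζ'
  have hmul' := map_mul_of_zeta_comp hwt (toQSym_nil wt _) (comul_toQSym wt _)
    (fun n x => toQSym_mem_grading wt fun w => ζ (word d w)) (fun x y => by
      rw [hζ', hζ', hζ', hmul])
  refine ⟨⟨⟨toQSym_nil wt _, hmul', counit_toQSym wt _, comul_toQSym wt _,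
    map_antipode_of_bialgebra _ (toQSym_nil wt _) hmul' (counit_toQSym wt _) (comul_toQSym wt _),
    fun n x => toQSym_mem_grading wt _⟩, hζ⟩, fun f hf => ?_⟩
  exact eq_of_zeta_comp_eq hf.map_one (toQSym_nil wt _) hf.map_comul (comul_toQSym wt _)
    hf.map_mem (fun n x => toQSym_mem_grading wt _)
    fun x => (LinearMap.congr_fun hf.char_comp x).trans (hζ' x).symm

end QuasiShuffle

/-! ### Pulling back characters along bialgebra maps -/

/-- The bialgebra homomorphism underlying a morphism of graded Hopf algebras. -/
def IsGradedHopfMorphism.toBialgHom {H K : Type*} [Ring H] [HopfAlgebra ℂ H] [Ring K]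
    [HopfAlgebra ℂ K] {𝒜 : ℕ → Submodule ℂ H} {ℬ : ℕ → Submodule ℂ K} {f : H →ₗ[ℂ] K}
    (hf : IsGradedHopfMorphism 𝒜 ℬ f) : H →ₐc[ℂ] K :=
  BialgHom.ofAlgHom (AlgHom.ofLinearMap f hf.map_one hf.map_mul)
    (AlgHom.ext hf.map_counit) (AlgHom.ext fun x => (hf.map_comul x).symm)

/-- Composition with a bialgebra homomorphism is a homomorphism between the groups of
characters. -/
def AlgHom.convComp {H K : Type*} [CommRing H] [HopfAlgebra ℂ H] [CommRing K]
    [HopfAlgebra ℂ K] (h : H →ₐc[ℂ] K) : WithConv (K →ₐ[ℂ] ℂ) →* WithConv (H →ₐ[ℂ] ℂ) :=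
  MonoidHom.mk' (fun f => WithConv.toConv (f.ofConv.comp h)) fun f g => by
    rw [AlgHom.convMul_comp_bialgHom_distrib]

namespace QuasiShuffle

variable {A : Type u} {d : A → A → Option A} [IsContraction d]

theorem convMul_word (f g : WithConv (QuasiShuffle d →ₐ[ℂ] ℂ)) (w : List A) :
    (f * g) (word d w) =
      ∑ i ∈ Finset.range (w.length + 1), f (word d (w.take i)) * g (word d (w.drop i)) := by
  rw [AlgHom.convMul_apply, comul_def, comul_word, map_sum]
  exact Finset.sum_congr rfl fun i _ => Algebra.TensorProduct.lift_tmul ..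

theorem algHom_ext {f g : QuasiShuffle d →ₐ[ℂ] ℂ} (h : ∀ w, f (word d w) = g (word d w)) :
    f = g :=
  AlgHom.toLinearMap_injective (hom_ext h)

end QuasiShuffle

/-! ### Exponential characters of shuffle algebras -/

namespace ShuffleAlgebra

open QuasiShuffle

variable {ι : Type u}

theorem isAdditiveWeight (wt : ι → ℕ) : IsAdditiveWeight (noContraction ι) wt :=
  fun _ _ _ h => by cases h

/-- The value `t(α₁) ⋯ t(α_ℓ) / ℓ!` of an exponential character. -/
def expWord {A : Type*} (t : A → ℂ) (α : List A) : ℂ := (α.map t).prod / α.length.factorial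

/-- With all letters of weight one the grading records the length, on which alone the denominator
depends. This applies to a shuffle product of two words, all of whose terms have the same length. -/
theorem lift_expWord_prep (t : ι → ℂ) (a : ι) {n : ℕ} {x : ShuffleAlgebra ι}
    (hx : x ∈ QuasiShuffle.grading (noContraction ι) (fun _ => 1) n) :
    lift (expWord t) (prep (noContraction ι) (some a) x) =
      t a / (n + 1) * lift (d := noContraction ι) (expWord t) x := by
  have h : QuasiShuffle.grading (noContraction ι) (fun _ => 1) n ≤
      LinearMap.eqLocus (lift (expWord t) ∘ₗ prep (noContraction ι) (some a))
        ((t a / (n + 1)) • lift (expWord t)) := by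
    refine grading_le fun w hw => ?_
    have hw' : w.length = n := by simpa using hw
    simp only [LinearMap.mem_eqLocus, LinearMap.comp_apply, prep_some_word, lift_word,
      LinearMap.smul_apply, smul_eq_mul, expWord, List.map_cons, List.prod_cons, List.length_cons,
      hw', Nat.factorial_succ]
    push_cast
    rw [div_mul_div_comm]
  exact h hx

/-- The character `v_α ↦ t(α₁) ⋯ t(α_ℓ) / ℓ!` of the shuffle algebra. -/
def expChar (t : ι → ℂ) : ShuffleAlgebra ι →ₐ[ℂ] ℂ :=
  AlgHom.ofLinearMap (lift (expWord t)) (by simp [one_def, expWord])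
    (map_mul_of_word _ (by simp [one_def, expWord]) fun a u b v h1 h2 _ => by
      have hmem : ∀ w : List ι, word (noContraction ι) w ∈
          QuasiShuffle.grading (noContraction ι) (fun _ => 1) w.length :=
        fun w => word_mem_grading_of_eq (by simp)
      have hm := fun x y => mul_mem_grading (isAdditiveWeight (ι := ι) fun _ => 1)
        (hmem x) (hmem y)
      have e : ∀ (c : ι) (w : List ι), lift (expWord t) (word (noContraction ι) (c :: w)) =
          t c / (w.length + 1) * lift (expWord t) (word (noContraction ι) w) := fun c w => by
        rw [← prep_some_word, lift_expWord_prep t c (hmem w)]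
      -- With p = |u| + 1 and q = |v| + 1, the shuffles starting with `a` and those starting with
      -- `b` yield the fractions p/(p+q) and q/(p+q) of the product of the two values.
      have e1 := lift_expWord_prep t a (hm u (b :: v))
      have e2 := lift_expWord_prep t b (hm (a :: u) v)
      rw [h1] at e1
      rw [h2] at e2
      rw [← prep_some_word a u, ← prep_some_word b v, cons_mul_cons_word, prep_some_word,
        prep_some_word, map_add, map_add, e1, e2, e, e]
      simp only [noContraction, prep_none, LinearMap.zero_apply, map_zero, List.length_cons]
      push_cast
      have hu : (u.length + 1 : ℂ) ≠ 0 := Nat.cast_add_one_ne_zero _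
      have hv : (v.length + 1 : ℂ) ≠ 0 := Nat.cast_add_one_ne_zero _
      have huv : (u.length + (v.length + 1) + 1 : ℂ) ≠ 0 := by
        exact_mod_cast Nat.cast_add_one_ne_zero (R := ℂ) (u.length + (v.length + 1))
      have huv' : (u.length + 1 + v.length + 1 : ℂ) ≠ 0 := by
        exact_mod_cast Nat.cast_add_one_ne_zero (R := ℂ) (u.length + 1 + v.length)
      field_simp
      ring)

theorem expChar_v (t : ι → ℂ) (α : List ι) : expChar t (v α) = expWord t α :=
  lift_word _ _

-- The scalars c^i/i! and c'^(n-i)/(n-i)! of the two factors of a word add up by the binomial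
-- theorem.
open WithConv in
theorem expChar_smul_mul_expChar_smul (t : ι → ℂ) (c c' : ℂ) :
    toConv (expChar (c • t)) * toConv (expChar (c' • t)) = toConv (expChar ((c + c') • t)) := by
  apply WithConv.ofConv_injective
  refine algHom_ext fun α => ?_
  have hs : ∀ (c : ℂ) (β : List ι), expWord (c • t) β =
      c ^ β.length * (β.map t).prod / β.length.factorial := fun c β => by
    rw [expWord]
    congr 1
    induction β with
    | nil => simp
    | cons b β ih =>
      rw [List.map_cons, List.prod_cons, ih, List.map_cons, List.prod_cons, List.length_cons,
        pow_succ, Pi.smul_apply, smul_eq_mul]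
      ring
  refine (convMul_word _ _ α).trans ?_
  change ∑ i ∈ Finset.range (α.length + 1), expChar (c • t) (v (α.take i)) *
    expChar (c' • t) (v (α.drop i)) = expChar ((c + c') • t) (v α)
  simp only [expChar_v, hs]
  rw [add_pow, Finset.sum_mul, Finset.sum_div]
  refine Finset.sum_congr rfl fun i hi => ?_
  have hi' : i ≤ α.length := Nat.lt_succ_iff.mp (Finset.mem_range.mp hi)
  rw [List.length_take, List.length_drop, min_eq_left hi', Nat.cast_choose ℂ hi',
    ← List.take_append_drop i α, List.map_append, List.prod_append, List.take_append_drop]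
  have h1 : (i.factorial : ℂ) ≠ 0 := Nat.cast_ne_zero.mpr (Nat.factorial_ne_zero _)
  have h2 : ((α.length - i).factorial : ℂ) ≠ 0 := Nat.cast_ne_zero.mpr (Nat.factorial_ne_zero _)
  have h3 : (α.length.factorial : ℂ) ≠ 0 := Nat.cast_ne_zero.mpr (Nat.factorial_ne_zero _)
  field_simp

theorem expChar_zero : WithConv.toConv (expChar (0 : ι → ℂ)) = 1 := by
  apply WithConv.ofConv_injective
  refine algHom_ext fun α => ?_
  refine (expChar_v _ α).trans ?_
  change _ = algebraMap ℂ ℂ (counitMap (noContraction ι) (word _ α))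
  rw [counitMap_word]
  cases α <;> simp [expWord]

open WithConv in
theorem inv_expChar (t : ι → ℂ) : (toConv (expChar t))⁻¹ = toConv (expChar ((-1 : ℂ) • t)) := by
  refine inv_eq_of_mul_eq_one_right ?_
  have h := expChar_smul_mul_expChar_smul t 1 (-1)
  rwa [one_smul, add_neg_cancel, zero_smul, expChar_zero] at h

end ShuffleAlgebra

/-! ### The characters of `S(V)` -/

/-! ### Blocks with even parts before odd parts -/

namespace QSym

/-- In the definition the list is coerced monadically to a `List ℕ`. This form speaks of the parts
in `ℕ+` themselves, as `blockCoeff_eq` does for the coefficient. -/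
theorem noOddEven_iff {b : List ℕ+} :
    NoOddEven b ↔ b.IsChain fun x y : ℕ+ => ¬ (Odd (x : ℕ) ∧ Even (y : ℕ)) := by
  rw [← List.isChain_map PNat.val (R := fun x y => ¬ (Odd x ∧ Even y)),
    ← List.flatMap_pure_eq_map]
  rfl

theorem blockCoeff_eq (b : List ℕ+) :
    blockCoeff b = 1 / ((b.countP (fun a : ℕ+ => decide (Odd (a : ℕ)))).factorial *
      (b.countP (fun a : ℕ+ => decide (Even (a : ℕ)))).factorial : ℂ) := by
  have h : ∀ p : ℕ → Bool, (b >>= fun a => pure (a : ℕ)).countP p =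
      b.countP fun a : ℕ+ => p (a : ℕ) := fun p => by
    have h' : (b >>= fun a => pure (a : ℕ)) = b.map PNat.val := List.flatMap_pure_eq_map ..
    rw [h', List.countP_map]
    rfl
  rw [← h fun n => decide (Odd n), ← h fun n => decide (Even n)]
  rfl

theorem noOddEven_append {e o : List ℕ+} (he : ∀ x ∈ e, Even (x : ℕ)) (ho : ∀ x ∈ o, Odd (x : ℕ)) :
    NoOddEven (e ++ o) := by
  have h : (e ++ o).Pairwise fun x y : ℕ+ => ¬ (Odd (x : ℕ) ∧ Even (y : ℕ)) := by
    refine List.pairwise_append.mpr ⟨?_, ?_, ?_⟩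
    · exact List.pairwise_of_forall_mem_list
        fun x hx y _ h => Nat.not_odd_iff_even.mpr (he x hx) h.1
    · exact List.pairwise_of_forall_mem_list
        fun x _ y hy h => Nat.not_odd_iff_even.mpr h.2 (ho y hy)
    · exact fun x hx y _ h => Nat.not_odd_iff_even.mpr (he x hx) h.1
  exact noOddEven_iff.mpr h.isChain

/-- Once an odd part occurs, every later part is odd. -/
theorem exists_append_of_noOddEven {b : List ℕ+} (hb : NoOddEven b) :
    ∃ e o, b = e ++ o ∧ (∀ x ∈ e, Even (x : ℕ)) ∧ ∀ x ∈ o, Odd (x : ℕ) := by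
  rw [noOddEven_iff] at hb
  induction b with
  | nil => exact ⟨[], [], by simp⟩
  | cons a b ih =>
    obtain ⟨e, o, rfl, he, ho⟩ := ih hb.tail
    rcases Nat.even_or_odd (a : ℕ) with ha | ha
    · exact ⟨a :: e, o, rfl, List.forall_mem_cons.mpr ⟨ha, he⟩, ho⟩
    · cases e with
      | nil => exact ⟨[], a :: o, rfl, he, List.forall_mem_cons.mpr ⟨ha, ho⟩⟩
      | cons x e => exact absurd ⟨ha, he x (by simp)⟩ (List.isChain_cons_cons.mp hb).1

/-- The indicator function of the even numbers. -/
def evenInd (a : ℕ+) : ℂ := if Even (a : ℕ) then 1 else 0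

/-- The indicator function of the odd numbers. -/
def oddInd (a : ℕ+) : ℂ := if Odd (a : ℕ) then 1 else 0

theorem prod_evenInd_eq_zero {b : List ℕ+} (h : ¬ ∀ x ∈ b, Even (x : ℕ)) :
    (b.map evenInd).prod = 0 := by
  push Not at h
  obtain ⟨x, hx, hodd⟩ := h
  exact List.prod_eq_zero (List.mem_map.mpr ⟨x, hx, if_neg (by simpa using hodd)⟩)

theorem prod_smul_oddInd_eq_zero {b : List ℕ+} (c : ℂ) (h : ¬ ∀ x ∈ b, Odd (x : ℕ)) :
    (b.map (c • oddInd)).prod = 0 := by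
  push Not at h
  obtain ⟨x, hx, heven⟩ := h
  exact List.prod_eq_zero (List.mem_map.mpr ⟨x, hx, by
    rw [Pi.smul_apply, oddInd, if_neg (by simpa using heven), smul_zero]⟩)

theorem prod_evenInd {b : List ℕ+} (h : ∀ x ∈ b, Even (x : ℕ)) : (b.map evenInd).prod = 1 :=
  List.prod_eq_one fun y hy => by
    obtain ⟨x, hx, rfl⟩ := List.mem_map.mp hy
    exact if_pos (h x hx)

theorem prod_smul_oddInd {b : List ℕ+} (c : ℂ) (h : ∀ x ∈ b, Odd (x : ℕ)) :
    (b.map (c • oddInd)).prod = c ^ b.length := by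
  rw [List.prod_eq_pow_card _ c, List.length_map]
  intro y hy
  obtain ⟨x, hx, rfl⟩ := List.mem_map.mp hy
  rw [Pi.smul_apply, oddInd, if_pos (h x hx), smul_eq_mul, mul_one]

-- A cut contributes only if it has even parts alone before it and odd parts alone after it. At most
-- one cut does so, and it contributes (1/E!)(c^O/O!).
open ShuffleAlgebra in
theorem sum_expWord_evenInd_oddInd (c : ℂ) (b : List ℕ+) :
    ∑ i ∈ Finset.range (b.length + 1),
        expWord evenInd (b.take i) * expWord (c • oddInd) (b.drop i) =
      if NoOddEven b then 
        c ^ b.countP (fun a : ℕ+ => decide (Odd (a : ℕ))) * blockCoeff b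
      else 0 := by
  have hterm : ∀ i, (¬ ∀ x ∈ b.take i, Even (x : ℕ)) ∨ (¬ ∀ x ∈ b.drop i, Odd (x : ℕ)) →
      expWord evenInd (b.take i) * expWord (c • oddInd) (b.drop i) = 0 := by
    rintro i (h | h)
    · rw [expWord, prod_evenInd_eq_zero h, zero_div, zero_mul]
    · rw [expWord, expWord, prod_smul_oddInd_eq_zero c h, zero_div, mul_zero]
  split_ifs with hb
  · obtain ⟨e, o, rfl, he, ho⟩ := exists_append_of_noOddEven hb
    have hee : e.countP (fun a : ℕ+ => decide (Even (a : ℕ))) = e.length := by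
      simpa [List.countP_eq_length] using he
    have hoo : o.countP (fun a : ℕ+ => decide (Odd (a : ℕ))) = o.length := by
      simpa [List.countP_eq_length] using ho
    have heo : e.countP (fun a : ℕ+ => decide (Odd (a : ℕ))) = 0 := by
      simpa [List.countP_eq_zero] using he
    have hoe : o.countP (fun a : ℕ+ => decide (Even (a : ℕ))) = 0 := by
      simpa [List.countP_eq_zero] using ho
    rw [Finset.sum_eq_single e.length]
    · rw [List.take_left, List.drop_left, expWord, expWord, prod_evenInd he,
        prod_smul_oddInd c ho, blockCoeff_eq, List.countP_append, List.countP_append, hee, hoo, heo,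
        hoe, zero_add, add_zero]
      ring
    · intro i hi hne
      have hi' : i < (e ++ o).length + 1 := Finset.mem_range.mp hi
      rw [List.length_append] at hi'
      refine hterm i ?_
      -- Counting even parts on both sides of the cut forces its position to be the length of `e`.
      by_contra! h
      have h1 : ((e ++ o).take i).countP (fun a : ℕ+ => decide (Even (a : ℕ))) =
          ((e ++ o).take i).length := List.countP_eq_length.mpr fun x hx => decide_eq_true (h.1 x hx)
      have h2 : ((e ++ o).drop i).countP (fun a : ℕ+ => decide (Even (a : ℕ))) = 0 :=
        List.countP_eq_zero.mpr fun x hx => by simpa using h.2 x hx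
      have h3 := congrArg (List.countP fun a : ℕ+ => decide (Even (a : ℕ)))
        (List.take_append_drop i (e ++ o))
      rw [List.countP_append, h1, h2, List.countP_append, hee, hoe, List.length_take,
        List.length_append] at h3
      omega
    · simp
  · refine Finset.sum_eq_zero fun i _ => hterm i ?_
    by_contra! h
    exact hb (List.take_append_drop i b ▸ noOddEven_append h.1 h.2)

/-! ### The sign automorphism of `QSym` as a rescaling -/

open QuasiShuffle

theorem prod_map_neg_one_pow (α : List ℕ+) :
    (α.map fun a : ℕ+ => (-1 : ℂ) ^ (a : ℕ)).prod = (-1) ^ (α.map PNat.val).sum := by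
  induction α with
  | nil => simp
  | cons a α ih => simp [ih, pow_add]

theorem toLinearMap_sign : sign.toLinearMap = scale addParts fun a : ℕ+ => (-1 : ℂ) ^ (a : ℕ) :=
  hom_ext fun α => by
    rw [scale_word, prod_map_neg_one_pow]
    exact lift_word _ _

theorem isGradedHopfMorphism_sign : IsGradedHopfMorphism grading grading sign.toLinearMap := by
  rw [toLinearMap_sign]
  exact isGradedHopfMorphism_scale (fun a b e h => by cases h; simp [pow_add]) PNat.val

end QSym

/-! ### Factorization of the canonical character into even and odd parts -/

namespace ShuffleAlgebra

open QuasiShuffle WithConv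

variable {ι : Type u} (deg : ι → ℕ+)

/-- The value of the canonical character of `S(V)` on a word. -/
def charWord (α : List ι) : ℂ :=
  if QSym.NoOddEven (α.map deg) then QSym.blockCoeff (α.map deg) else 0

/-- `charWord` vanishes on blocks with an odd part before an even one, so the cuttings excluded from
`QSym.S` have weight zero here. -/
theorem Phi_eq_toQSym : Phi deg = toQSym (noContraction ι) deg (charWord deg) :=
  hom_ext fun α => by
    rw [Phi, toQSym, lift_word, lift_word, QSym.S, blockings_map, List.filter_map, List.map_map]
    induction blockings α with
    | nil => simp
    | cons B L ih =>
      rw [List.map_cons, List.sum_cons, ← ih, List.filter_cons]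
      by_cases h : ∀ b ∈ B, QSym.NoOddEven (b.map deg)
      · have hB : B.map (charWord deg) = (B.map (List.map deg)).map QSym.blockCoeff := by
          rw [List.map_map]
          exact List.map_congr_left fun b hb => if_pos (h b hb)
        rw [if_pos (by simpa using h), hB, List.map_cons, List.sum_cons, Function.comp_apply,
          List.map_map (g := QSym.blockSum)]
        rfl
      · rw [if_neg (by simpa using h), List.prod_eq_zero, zero_smul, zero_add]
        push Not at h
        obtain ⟨b, hb, hb'⟩ := h
        exact List.mem_map.mpr ⟨b, hb, if_neg hb'⟩

/-- The exponential character supported on the words whose letters have even degree. -/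
def evenChar : WithConv (ShuffleAlgebra ι →ₐ[ℂ] ℂ) := toConv (expChar (QSym.evenInd ∘ deg))

/-- The exponential character, with parameter `c`, supported on the words whose letters have odd
degree. -/
def oddChar (c : ℂ) : WithConv (ShuffleAlgebra ι →ₐ[ℂ] ℂ) :=
  toConv (expChar (c • (QSym.oddInd ∘ deg)))

theorem oddChar_mul_oddChar (c c' : ℂ) :
    oddChar deg c * oddChar deg c' = oddChar deg (c + c') :=
  expChar_smul_mul_expChar_smul _ c c'

theorem inv_oddChar (c : ℂ) : (oddChar deg c)⁻¹ = oddChar deg (-c) := by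
  rw [oddChar, inv_expChar, smul_smul, neg_one_mul, oddChar]

/-- The parameter marks the odd letters: c = 1 gives the canonical character and c = -1 its bar. -/
theorem evenChar_mul_oddChar_v (c : ℂ) (α : List ι) :
    (evenChar deg * oddChar deg c) (v α) =
      c ^ (α.map deg).countP (fun a : ℕ+ => decide (Odd (a : ℕ))) * charWord deg α := by
  have h := QSym.sum_expWord_evenInd_oddInd c (α.map deg)
  rw [List.length_map] at h
  rw [charWord, mul_ite, mul_zero, ← h, v, convMul_word]
  refine Finset.sum_congr rfl fun i _ => ?_
  refine (congrArg₂ (· * ·) (expChar_v _ (α.take i)) (expChar_v _ (α.drop i))).trans ?_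
  rw [expWord, expWord, expWord, expWord, ← List.map_take, ← List.map_drop, List.map_map,
    List.map_map, List.length_map, List.length_map]
  rfl

theorem zeta_v (α : List ι) : zeta deg (v α) = charWord deg α := by
  rw [zeta, Phi_eq_toQSym]
  exact zeta_toQSym deg _ (by simp [charWord, QSym.noOddEven_iff, QSym.blockCoeff_eq]) α

/-- Shows that ζ_S(V) is multiplicative without knowing this of `Phi`, whose multiplicativity is
then a consequence. -/
theorem zeta_eq : zeta deg = (evenChar deg * oddChar deg 1).ofConv.toLinearMap :=
  hom_ext fun α => by
    have h := evenChar_mul_oddChar_v deg 1 α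
    rw [one_pow, one_mul, ← zeta_v] at h
    exact h.symm

theorem isCombinatorialHopfAlgebra :
    IsCombinatorialHopfAlgebra (grading deg) (zeta deg) where
  toIsGradedConnected := isGradedConnected_grading (isAdditiveWeight _) fun i => (deg i).pos
  char_one := by rw [zeta_eq]; exact map_one (evenChar deg * oddChar deg 1).ofConv
  char_mul := by rw [zeta_eq]; exact map_mul (evenChar deg * oddChar deg 1).ofConv

theorem isCanonicalMorphism_Phi :
    IsCanonicalMorphism (grading deg) (zeta deg) (Phi deg) := by
  have h := isCanonicalMorphism_toQSym (wt := deg) (isAdditiveWeight _)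
    (isCombinatorialHopfAlgebra deg).char_one (isCombinatorialHopfAlgebra deg).char_mul
  have e : (fun α => zeta deg (word (noContraction ι) α)) = charWord deg := funext (zeta_v deg)
  rwa [e, ← Phi_eq_toQSym] at h

/-! ### The map `Θ_QSym` -/

theorem _root_.QSym.isThetaQSym_toQSym :
    IsThetaQSym (toQSym addParts id fun α => QSym.nu (QSym.M α)) := by
  have hadd : IsAdditiveWeight addParts PNat.val := fun a b c h => by cases h; rfl
  exact ⟨⟨isGradedConnected_grading hadd PNat.pos, map_one QSym.nu, map_mul QSym.nu⟩,
    isCanonicalMorphism_toQSym (wt := id) hadd (map_one QSym.nu) (map_mul QSym.nu)⟩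

/-- The morphism `Φ_{S(V)}` of bialgebras. -/
def phi : ShuffleAlgebra ι →ₐc[ℂ] QSym :=
  (isCanonicalMorphism_Phi deg).1.toIsGradedHopfMorphism.toBialgHom

theorem convComp_phi_zeta :
    AlgHom.convComp (phi deg) (toConv QSym.zeta) = evenChar deg * oddChar deg 1 :=
  WithConv.ofConv_injective (AlgHom.toLinearMap_injective (zeta_eq deg))

/-- The sign (-1)^n of a word of degree n is (-1) to the number of its odd letters, which changes
the parameter from 1 to -1. -/
theorem convComp_sign_phi_zeta :
    AlgHom.convComp ((QSym.isGradedHopfMorphism_sign.toBialgHom).comp (phi deg))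
      (toConv QSym.zeta) = evenChar deg * oddChar deg (-1) := by
  apply WithConv.ofConv_injective
  refine algHom_ext fun α => ?_
  refine Eq.trans ?_ (evenChar_mul_oddChar_v deg (-1) α).symm
  change QSym.zeta (QSym.sign.toLinearMap (Phi deg (v α))) = _
  have hscale : ∀ (n : ℕ) (x : QSym), x ∈ QSym.grading n →
      QSym.sign.toLinearMap x = (-1 : ℂ) ^ n • x := fun n x hx => by
    have h : QSym.grading n ≤ LinearMap.eqLocus QSym.sign.toLinearMap
        ((-1 : ℂ) ^ n • LinearMap.id) := grading_le fun β hβ => by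
      rw [LinearMap.mem_eqLocus, QSym.toLinearMap_sign, scale_word, QSym.prod_map_neg_one_pow, hβ]
      rfl
    exact h hx
  have hΦ : Phi deg (v α) ∈ QSym.grading (α.map fun i => (deg i : ℕ)).sum :=
    (isCanonicalMorphism_Phi deg).1.map_mem _ _ (word_mem_grading _ α)
  have hparity : (-1 : ℂ) ^ (α.map fun i => (deg i : ℕ)).sum =
      (-1) ^ (α.map deg).countP (fun a : ℕ+ => decide (Odd (a : ℕ))) := by
    induction α with
    | nil => simp
    | cons i α ih =>
      have ih := ih ((isCanonicalMorphism_Phi deg).1.map_mem _ _ (word_mem_grading _ α))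
      rw [List.map_cons, List.map_cons, List.sum_cons, pow_add, ih, List.countP_cons]
      rcases Nat.even_or_odd (deg i : ℕ) with h | h
      · rw [h.neg_one_pow, if_neg (by simpa using h), add_zero, one_mul]
      · rw [h.neg_one_pow, if_pos (by simpa using h), pow_succ, mul_comm]
  rw [hscale _ _ hΦ, map_smul, hparity, smul_eq_mul]
  exact congrArg _ (zeta_v deg α)

/-- Expressed as a pullback along a bialgebra map, the bar involution respects convolution inverses.
-/
theorem convComp_phi_bar (χ : QSym →ₐ[ℂ] ℂ) :
    AlgHom.convComp (phi deg) (toConv (QSym.bar χ)) =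
      AlgHom.convComp ((QSym.isGradedHopfMorphism_sign.toBialgHom).comp (phi deg)) (toConv χ) :=
  WithConv.ofConv_injective (AlgHom.ext fun _ => rfl)

/-- (e o_(-1))⁻¹ (e o_1) = o_1 e⁻¹ e o_1 = o_2: the even factor cancels, and the two odd factors
produce the 2 in `Theta`. -/
theorem convComp_phi_nu : AlgHom.convComp (phi deg) (toConv QSym.nu) = oddChar deg 2 := by
  rw [QSym.nu, toConv_ofConv, map_mul, convComp_phi_bar, toConv_ofConv, map_inv, convComp_sign_phi_zeta,
    convComp_phi_zeta,
    mul_inv_rev, inv_oddChar, neg_neg, mul_assoc, inv_mul_cancel_left, oddChar_mul_oddChar,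
    one_add_one_eq_two]

/-! ### The map `Θ_{S(V)}` -/

theorem prod_map_eq_zero_of_not_isOdd {t : ι → ℂ} (ht : ∀ i, ¬ Odd (deg i : ℕ) → t i = 0)
    {α : List ι} (h : ¬ IsOdd deg α) : (α.map t).prod = 0 := by
  rw [IsOdd] at h
  push Not at h
  obtain ⟨i, hi, hodd⟩ := h
  exact List.prod_eq_zero (List.mem_map.mpr ⟨i, hi, ht i (by simpa using hodd)⟩)

theorem Theta_eq_scale :
    Theta deg = scale (noContraction ι) ((2 : ℂ) • (QSym.oddInd ∘ deg)) :=
  hom_ext fun α => by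
    rw [Theta, lift_word, scale_word]
    split_ifs with h
    · rw [List.prod_eq_pow_card _ 2, List.length_map, v]
      intro y hy
      obtain ⟨i, hi, rfl⟩ := List.mem_map.mp hy
      simp [QSym.oddInd, h i hi]
    · rw [prod_map_eq_zero_of_not_isOdd deg (fun i hi => by
        rw [Pi.smul_apply, Function.comp_apply, QSym.oddInd, if_neg hi, smul_zero]) h, zero_smul]

theorem isGradedHopfMorphism_Theta :
    IsGradedHopfMorphism (grading deg) (grading deg) (Theta deg) := by
  rw [Theta_eq_scale]
  exact isGradedHopfMorphism_scale (fun _ _ _ h => by cases h) _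

theorem range_Theta : LinearMap.range (Theta deg) = oddPart deg := by
  refine le_antisymm ?_ (Submodule.span_le.mpr ?_)
  · rintro _ ⟨x, rfl⟩
    have h : (⊤ : Submodule ℂ (ShuffleAlgebra ι)) ≤ (oddPart deg).comap (Theta deg) := by
      rw [← (wordBasis (noContraction ι)).span_eq, Submodule.span_le]
      rintro _ ⟨α, rfl⟩
      change Theta deg (word _ α) ∈ oddPart deg
      rw [Theta, lift_word]
      split_ifs with hα
      · exact Submodule.smul_mem _ _ (Submodule.subset_span ⟨α, hα, rfl⟩)
      · exact Submodule.zero_mem _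
    exact h Submodule.mem_top
  · rintro _ ⟨α, hα : IsOdd deg α, rfl⟩
    refine ⟨((2 : ℂ) ^ α.length)⁻¹ • v α, ?_⟩
    rw [map_smul, Theta, v, lift_word, if_pos hα, v, smul_smul, inv_mul_cancel₀ (by simp), one_smul]

/-- Both sides are o_2. On an odd word of length ℓ the canonical character is 1/ℓ! and `Theta`
supplies 2^ℓ; a letter of even degree makes both sides vanish. -/
theorem zeta_comp_Theta : zeta deg ∘ₗ Theta deg = QSym.nu.toLinearMap ∘ₗ Phi deg := by
  have h : QSym.nu.toLinearMap ∘ₗ Phi deg = (oddChar deg 2).ofConv.toLinearMap :=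
    congrArg (fun f : WithConv (ShuffleAlgebra ι →ₐ[ℂ] ℂ) => f.ofConv.toLinearMap)
      (convComp_phi_nu deg)
  rw [h]
  refine hom_ext fun α => ?_
  rw [Theta_eq_scale, LinearMap.comp_apply, scale_word, map_smul, smul_eq_mul]
  refine Eq.trans ?_ (expChar_v _ α).symm
  by_cases hα : IsOdd deg α
  · have hodd : ∀ a ∈ α.map deg, Odd (a : ℕ) := by simpa [IsOdd] using hα
    have h1 : QSym.NoOddEven (α.map deg) :=
      QSym.noOddEven_append (e := []) (by simp) hodd
    have h2 : (α.map deg).countP (fun a : ℕ+ => decide (Odd (a : ℕ))) = α.length := by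
      rw [← List.length_map (f := deg)]
      exact List.countP_eq_length.mpr fun a ha => decide_eq_true (hodd a ha)
    have h3 : (α.map deg).countP (fun a : ℕ+ => decide (Even (a : ℕ))) = 0 :=
      List.countP_eq_zero.mpr fun a ha => by simpa using hodd a ha
    rw [expWord, ← v, zeta_v, charWord, if_pos h1, QSym.blockCoeff_eq, h2, h3, Nat.factorial_zero,
      Nat.cast_one, mul_one, mul_one_div]
  · rw [expWord, prod_map_eq_zero_of_not_isOdd deg (fun i hi => by
      rw [Pi.smul_apply, Function.comp_apply, QSym.oddInd, if_neg hi, smul_zero]) hα, zero_mul,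
      zero_div]

/-- Both composites are graded coalgebra maps to `QSym`, so `zeta_comp_Theta` suffices to identify
them. -/
theorem Phi_comp_Theta {ΘQ : QSym →ₗ[ℂ] QSym} (hΘ : IsThetaQSym ΘQ) :
    Phi deg ∘ₗ Theta deg = ΘQ ∘ₗ Phi deg := by
  have hΦ := (isCanonicalMorphism_Phi deg).1
  have hT := isGradedHopfMorphism_Theta deg
  have hQ := hΘ.2.1
  refine eq_of_zeta_comp_eq (wt := fun i => (deg i : ℕ)) ?_ ?_ (fun x => ?_) (fun x => ?_)
    (fun n x hx => hΦ.map_mem _ _ (hT.map_mem _ _ hx))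
    (fun n x hx => hQ.map_mem _ _ (hΦ.map_mem _ _ hx)) (fun x => ?_)
  · exact (congrArg _ hT.map_one).trans hΦ.map_one
  · exact (congrArg _ hΦ.map_one).trans hQ.map_one
  · rw [TensorProduct.map_comp]
    exact (hΦ.map_comul _).trans (congrArg _ (hT.map_comul x))
  · rw [TensorProduct.map_comp]
    exact (hQ.map_comul _).trans (congrArg _ (hΦ.map_comul x))
  · exact (LinearMap.congr_fun (zeta_comp_Theta deg) x).trans
      (LinearMap.congr_fun hQ.char_comp (Phi deg x)).symm

theorem isThetaMap_Theta : IsThetaMap (grading deg) (zeta deg) (Theta deg) :=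
  ⟨isCombinatorialHopfAlgebra deg, Phi deg, _, isCanonicalMorphism_Phi deg,
    QSym.isThetaQSym_toQSym, Phi_comp_Theta deg QSym.isThetaQSym_toQSym⟩

end ShuffleAlgebra

end

/-! ### The main theorem -/

theorem mainTheorem4 {ι : Type*} (deg : ι → ℕ+)
    (hdeg : ∀ n : ℕ, {α : List ι | (α.map fun i => (deg i : ℕ)).sum = n}.Finite) :
    IsGradedHopfMorphism (ShuffleAlgebra.grading deg) (ShuffleAlgebra.grading deg)
      (ShuffleAlgebra.Theta deg) ∧
    (∃ ΘQ : QSym →ₗ[ℂ] QSym, IsThetaQSym ΘQ ∧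
      ShuffleAlgebra.Phi deg ∘ₗ ShuffleAlgebra.Theta deg = ΘQ ∘ₗ ShuffleAlgebra.Phi deg ∧
      (ShuffleAlgebra.oddPart deg).map (ShuffleAlgebra.Phi deg) ≤ LinearMap.range ΘQ) ∧
    IsCanonicalMorphism (ShuffleAlgebra.grading deg) (ShuffleAlgebra.zeta deg)
      (ShuffleAlgebra.Phi deg) ∧
    IsThetaMap (ShuffleAlgebra.grading deg) (ShuffleAlgebra.zeta deg)
      (ShuffleAlgebra.Theta deg) ∧
    LinearMap.range (ShuffleAlgebra.Theta deg) = ShuffleAlgebra.oddPart deg ∧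
    IsPeakAlgebra (ShuffleAlgebra.grading deg) (ShuffleAlgebra.zeta deg)
      (ShuffleAlgebra.oddPart deg) := by
  have hΘ := QSym.isThetaQSym_toQSym
  have hcomm := ShuffleAlgebra.Phi_comp_Theta deg hΘ
  have hrange := ShuffleAlgebra.range_Theta deg
  refine ⟨ShuffleAlgebra.isGradedHopfMorphism_Theta deg, ⟨_, hΘ, hcomm, ?_⟩,
    ShuffleAlgebra.isCanonicalMorphism_Phi deg, ShuffleAlgebra.isThetaMap_Theta deg, hrange,
    _, ShuffleAlgebra.isThetaMap_Theta deg, hrange⟩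
  -- The image of S(O(V)) under `Phi` is the range of Φ ∘ Θ, that is, of Θ_QSym ∘ Φ.
  rw [← hrange, ← LinearMap.range_comp, hcomm]
  exact LinearMap.range_comp_le_range _ _
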